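/- Batched adversarial $K$-armed bandits. Let $K\ge 2$ be the number of arms, $T$ the horizon, and $B$ the number of batches, $1\le B\le T$. A reward sequence is an arbitrary array $r=(r_{k,t})_{k\in[K],t\in[T]}$ with entries in $[0,1]$, fixed in advance and unknown to the player. A non-adaptive policy fixes, before the game starts, a partition of the rounds $1,\dots,T$ into at most $B$ consecutive batches; at the beginning of each batch it draws at random the whole list of arms to be pulled in that batch, from a distribution that may depend on the arms it pulled and the rewards it received in the previous batches (and on nothing else about $r$). The player knows $K$, $T$ and $B$. If $a_t$ is the arm pulled in round $t$, the expected regret is \[ \mathrm{Reg}(\pi,r)=\max_{k\in[K]}\sum_{t=1}^T r_{k,t}-\mathbf{E}\Big[\sum_{t=1}^T r_{a_t,t}\Big], \] and the minimax regret is $\mathcal{R}(K,T,B)=\inf_{\pi}\sup_{r}\mathrm{Reg}(\pi,r)$, the infimum being over all non-adaptive policies and the supremum over all reward sequences. Theorem. The minimax regret is $\widetilde\Theta\big(\sqrt{T(K+T/B)}\big)$ when $K\le T$. More precisely, there are absolute constants $c,C>0$ such that for all $K\ge 2$ and $1\le B\le T$: (i) $\mathcal{R}(K,T,B)\le C\sqrt{T\,(K+T/B)\,\log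 K}$; (ii) if $K\le T$, then $\mathcal{R}(K,T,B)\ge c\sqrt{T\,(K+T/B)}$; and if $K>T$, then $\mathcal{R}(K,T,B)\ge c\,T$. -/

import Mathlib

/-- A (randomized) non-adaptive policy for batched adversarial bandits with arms `Fin K`, rounds
`Fin T` and at most `B` batches.  The partition of the rounds into batches is fixed before the game
starts; at the beginning of each batch the player draws the whole list of arms to be pulled in that
batch, knowing only the arms and the rewards of the previous batches. -/
structure NonAdaptivePolicy (K T B : ℕ) where
  /-- `batch t` is the batch that contains round `t`. -/
  batch : Fin T → Fin B
  /-- Batches are consecutive blocks of rounds; some of the `B` blocks may be empty. -/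
  batch_mono : Monotone batch
  /-- The conditional law of the list of arms played in batch `i`, given the list of
  (arm, reward) pairs observed in the previous batches.  An element of `stdSimplex ℝ α` is a
  probability distribution on the finite set `α`. -/
  play : (i : Fin B) → ({s : Fin T // batch s < i} → Fin K × ℝ) →
    stdSimplex ℝ ({t : Fin T // batch t = i} → Fin K)

namespace NonAdaptivePolicy

variable {K T B : ℕ}

/-- What the player has observed before batch `i`, if the arms pulled are `a` and the rewards of
the bandit are `r` (`r k t` is the reward of arm `k` in round `t`). -/
def observed (π : NonAdaptivePolicy K T B) (r : Fin K → Fin T → ℝ) (a : Fin T → Fin K)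
    (i : Fin B) : {s : Fin T // π.batch s < i} → Fin K × ℝ :=
  fun s => (a s, r (a s) s)

/-- The probability that the arms pulled in rounds `0, …, T - 1` are `a 0, …, a (T - 1)`. -/
noncomputable def prob (π : NonAdaptivePolicy K T B) (r : Fin K → Fin T → ℝ)
    (a : Fin T → Fin K) : ℝ :=
  ∏ i : Fin B, (π.play i (π.observed r a i)).1 (fun t => a t)

/-- The expected total reward collected by the policy. -/
noncomputable def expectedReward (π : NonAdaptivePolicy K T B) (r : Fin K → Fin T → ℝ) : ℝ :=
  ∑ a : Fin T → Fin K, π.prob r a * ∑ t : Fin T, r (a t) t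

/-- The expected regret: total reward of the best fixed arm in hindsight, minus the expected total
reward collected by the policy. -/
noncomputable def expectedRegret (π : NonAdaptivePolicy K T B) (r : Fin K → Fin T → ℝ) : ℝ :=
  (⨆ k : Fin K, ∑ t : Fin T, r k t) - π.expectedReward r

/-- The worst-case expected regret over all reward sequences with values in `[0, 1]`. -/
noncomputable def worstCaseRegret (π : NonAdaptivePolicy K T B) : EReal :=
  ⨆ (r : Fin K → Fin T → ℝ) (_ : ∀ k t, r k t ∈ Set.Icc (0 : ℝ) 1),
    ((π.expectedRegret r : ℝ) : EReal)

end NonAdaptivePolicy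

/-- The minimax regret: the best worst-case expected regret of a non-adaptive policy that uses at
most `B` batches. -/
noncomputable def minimaxRegret (K T B : ℕ) : EReal :=
  ⨅ π : NonAdaptivePolicy K T B, π.worstCaseRegret

/-!
The arms pulled by a policy have a law that is a product of conditional laws, one for each batch,
each depending on the past only. Everything rests on the fact that the later factors may be
integrated out (`IsSequentialLaw.sum_congr`, `IsSequentialLaw.sum_eq_of_conditional`); for a policy
this says that the arms pulled up to a batch are independent of the rewards of this batch and of
all later ones (`NonAdaptivePolicy.expect_congr`).

*Upper bound.* Exponential weights are run on batches of length `b = ⌈T / B⌉`, and the arms of a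
batch are drawn independently from the current weights `q`. The importance-weighted loss estimates
`X` of the rounds are unbiased. In the second-order regret bound of exponential weights
(`expWeights_regret`) a batch with `m` rounds contributes the expectation of `∑ₖ qₖ (∑ₜ Xₖₜ)²`:
its diagonal terms are at most `m K` in total, and its off-diagonal ones at most `m²`, since there
the estimates of different rounds are conditionally uncorrelated
(`expect_sum_armLaw_mul_sq_le`). The regret is therefore at most `log K / η + η T (K + b) / 2`.

*Lower bounds.* Each one averages the regret over a random reward sequence.

* If `T < K`, a single rewarding arm, chosen uniformly at random, is missed with constant
  probability (`le_minimaxRegret_of_lt`).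
* If rewards are constant on batches, with an independent fair sign for each batch, then the player
  cannot gain anything, while the best arm gains the absolute value of a Rademacher sum; by
  Khintchine's inequality and Cauchy-Schwarz this is of order `T / √B` (`le_minimaxRegret_batch`).
* If one arm is better than the others by `ε ~ √(K / T)`, then a change of measure
  (`NonAdaptivePolicy.sum_biasedWeight_expect`) and a Pinsker-type inequality
  (`NonAdaptivePolicy.expected_pulls_le`) show that the player pulls it too rarely, so that the
  regret is of order `√(K T)` (`le_minimaxRegret_sqrt`).
-/

/-! ### Laws that are built level by level -/

/-- The configuration `ω` with its coordinates of level `i` replaced by `x`. -/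
def overwrite {J A : Type*} {B : ℕ} (lev : J → Fin B) (i : Fin B) (ω : J → A)
    (x : {s // lev s = i} → A) : J → A :=
  fun s => if h : lev s = i then x ⟨s, h⟩ else ω s

lemma overwrite_of_ne {J A : Type*} {B : ℕ} {lev : J → Fin B} {i : Fin B} {s : J}
    (h : lev s ≠ i) (ω : J → A) (x : {s // lev s = i} → A) : overwrite lev i ω x s = ω s := by
  simp [overwrite, h]

@[simp] lemma overwrite_coe {J A : Type*} {B : ℕ} {lev : J → Fin B} {i : Fin B} (ω : J → A)
    (x : {s // lev s = i} → A) (s : {s // lev s = i}) : overwrite lev i ω x s = x s := by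
  simp [overwrite, s.2]

/-- `f` is a function of the coordinates of level less than `m` only. -/
def DependsBelow {J A R : Type*} {B : ℕ} (lev : J → Fin B) (m : ℕ) (f : (J → A) → R) : Prop :=
  ∀ ω ω' : J → A, (∀ s, (lev s : ℕ) < m → ω s = ω' s) → f ω = f ω'

lemma DependsBelow.mono {J A R : Type*} {B : ℕ} {lev : J → Fin B} {m n : ℕ} {f : (J → A) → R}
    (hf : DependsBelow lev m f) (hmn : m ≤ n) : DependsBelow lev n f :=
  fun ω ω' h => hf ω ω' fun s hs => h s (hs.trans_le hmn)

lemma DependsBelow.overwrite_eq {J A R : Type*} {B : ℕ} {lev : J → Fin B} {m : ℕ}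
    {f : (J → A) → R} (hf : DependsBelow lev m f) {i : Fin B} (hi : m ≤ i) (ω : J → A)
    (x : {s // lev s = i} → A) : f (overwrite lev i ω x) = f ω :=
  hf _ _ fun s hs => overwrite_of_ne (by rintro rfl; omega) ω x

/-- `∏ i, P i ω` is the law of a random configuration whose coordinates of level `i` are drawn
with conditional law `P i`, given those of the smaller levels. Nonnegativity of the factors is not
part of the definition, since identities between expectations do not need it. -/
structure IsSequentialLaw {J A : Type*} [Fintype J] [DecidableEq J] [Fintype A] {B : ℕ}
    (lev : J → Fin B) (P : Fin B → (J → A) → ℝ) : Prop where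
  dependsBelow : ∀ i : Fin B, DependsBelow lev (i + 1) (P i)
  sum_eq_one : ∀ (i : Fin B) (ω : J → A), ∑ x, P i (overwrite lev i ω x) = 1

section

variable {J A : Type*} [Fintype J] [DecidableEq J] [Fintype A] {B : ℕ}
  {lev : J → Fin B}

/-- Exchanging old and new coordinates of level `i` is an involution; hence overwriting them
preserves uniform sums. -/
lemma sum_sum_overwrite (i : Fin B) (f : (J → A) → ℝ) :
    ∑ ω, ∑ x, f (overwrite lev i ω x) = Fintype.card ({s // lev s = i} → A) * ∑ ω, f ω := by
  let g : (J → A) × ({s // lev s = i} → A) → (J → A) × ({s // lev s = i} → A) :=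
    fun z => (overwrite lev i z.1 z.2, fun s => z.1 s)
  have hg : Function.Involutive g := by
    rintro ⟨ω, x⟩
    refine Prod.ext (funext fun s => ?_) (funext fun s => ?_)
    · by_cases h : lev s = i <;> simp [g, overwrite, h]
    · simp [g]
  rw [← Fintype.sum_prod_type' fun ω x => f (overwrite lev i ω x)]
  have h := Equiv.sum_comp (Function.Involutive.toPerm g hg) fun z => f z.1
  simp only [Function.Involutive.coe_toPerm, g] at h
  rw [h, Fintype.sum_prod_type]
  simp [Finset.mul_sum]

variable [Nonempty A]

/-- Integrating out the coordinates of level `i` first. -/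
lemma sum_mul_eq_of_resample (i : Fin B) {G F F' : (J → A) → ℝ}
    (hG : ∀ ω x, G (overwrite lev i ω x) = G ω)
    (hF : ∀ ω, ∑ x, F (overwrite lev i ω x) = ∑ x, F' (overwrite lev i ω x)) :
    ∑ ω, G ω * F ω = ∑ ω, G ω * F' ω := by
  have hc : (Fintype.card ({s // lev s = i} → A) : ℝ) ≠ 0 := by
    exact_mod_cast Fintype.card_ne_zero
  apply mul_left_cancel₀ hc
  rw [← sum_sum_overwrite, ← sum_sum_overwrite]
  simp_rw [hG, ← Finset.mul_sum, hF]

/-- `truncatedLaw P m` keeps the conditional laws of the levels below `m` and makes the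
coordinates of the levels from `m` on uniform. -/
noncomputable def truncatedLaw (lev : J → Fin B) (P : Fin B → (J → A) → ℝ) (m : ℕ)
    (ω : J → A) : ℝ :=
  ∏ j : Fin B, if (j : ℕ) < m then P j ω else (Fintype.card ({s // lev s = j} → A) : ℝ)⁻¹

variable {P P' : Fin B → (J → A) → ℝ}

/-- Coordinates of level `m` may be made uniform if nothing else depends on them. -/
lemma sum_truncatedLaw_succ (hP : IsSequentialLaw lev P) {m : ℕ} (hm : m < B)
    {h : (J → A) → ℝ} (hh : DependsBelow lev m h) :
    ∑ ω, truncatedLaw lev P (m + 1) ω * h ω = ∑ ω, truncatedLaw lev P m ω * h ω := by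
  let i : Fin B := ⟨m, hm⟩
  let G : (J → A) → ℝ := fun ω => (∏ j ∈ Finset.univ.erase i,
    if (j : ℕ) < m then P j ω else (Fintype.card ({s // lev s = j} → A) : ℝ)⁻¹) * h ω
  have h1 : ∀ ω, truncatedLaw lev P (m + 1) ω * h ω = G ω * P i ω := by
    intro ω
    rw [truncatedLaw, ← Finset.mul_prod_erase _ _ (Finset.mem_univ i)]
    have : ∏ j ∈ Finset.univ.erase i, (if (j : ℕ) < m + 1 then P j ω else
        (Fintype.card ({s // lev s = j} → A) : ℝ)⁻¹) = ∏ j ∈ Finset.univ.erase i,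
        if (j : ℕ) < m then P j ω else (Fintype.card ({s // lev s = j} → A) : ℝ)⁻¹ := by
      refine Finset.prod_congr rfl fun j hj => ?_
      have hji : (j : ℕ) ≠ m := fun e => (Finset.mem_erase.1 hj).1 (Fin.ext e)
      have : ((j : ℕ) < m + 1) = ((j : ℕ) < m) := by ext; omega
      simp only [this]
    rw [this, if_pos (by simp [i])]
    ring
  have h2 : ∀ ω, truncatedLaw lev P m ω * h ω
      = G ω * (Fintype.card ({s // lev s = i} → A) : ℝ)⁻¹ := by
    intro ω
    rw [truncatedLaw, ← Finset.mul_prod_erase _ _ (Finset.mem_univ i), if_neg (by simp [i])]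
    ring
  simp_rw [h1, h2]
  refine sum_mul_eq_of_resample (lev := lev) i (fun ω x => ?_) fun ω => ?_
  · simp only [G]
    rw [hh.overwrite_eq le_rfl]
    congr 1
    refine Finset.prod_congr rfl fun j _ => ?_
    split_ifs with hj
    · exact (hP.dependsBelow j).overwrite_eq (by simpa [i] using hj) ω x
    · rfl
  · rw [hP.sum_eq_one, Finset.sum_const, Finset.card_univ, nsmul_eq_mul, mul_inv_cancel₀]
    exact_mod_cast Fintype.card_ne_zero

/-- The levels from `m` on do not influence the expectation of a function of the others. -/
lemma sum_truncatedLaw_eq (hP : IsSequentialLaw lev P) {m : ℕ} (hm : m ≤ B)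
    {h : (J → A) → ℝ} (hh : DependsBelow lev m h) :
    ∑ ω, (∏ i, P i ω) * h ω = ∑ ω, truncatedLaw lev P m ω * h ω := by
  obtain ⟨k, hk⟩ := Nat.exists_eq_add_of_le hm
  induction k generalizing m with
  | zero => obtain rfl : B = m := hk; simp [truncatedLaw]
  | succ k ih =>
    rw [ih (m := m + 1) (by omega) (hh.mono (Nat.le_succ m)) (by omega),
      sum_truncatedLaw_succ hP (by omega) hh]

/-- Two sequential laws with the same conditional laws below level `m` give the same expectation
to a function of the levels below `m`. -/
lemma IsSequentialLaw.sum_congr (hP : IsSequentialLaw lev P) (hP' : IsSequentialLaw lev P')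
    {m : ℕ} (hm : m ≤ B) (hPP' : ∀ j : Fin B, (j : ℕ) < m → P j = P' j)
    {h : (J → A) → ℝ} (hh : DependsBelow lev m h) :
    ∑ ω, (∏ i, P i ω) * h ω = ∑ ω, (∏ i, P' i ω) * h ω := by
  rw [sum_truncatedLaw_eq hP hm hh, sum_truncatedLaw_eq hP' hm hh]
  refine Finset.sum_congr rfl fun ω _ => ?_
  congr 1
  refine Finset.prod_congr rfl fun j _ => ?_
  split_ifs with hj
  · rw [hPP' j hj]
  · rfl

/-- If `h` and `h'` have the same conditional expectation given the levels below `i`,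
they have the same expectation. -/
lemma IsSequentialLaw.sum_eq_of_conditional (hP : IsSequentialLaw lev P) (i : Fin B)
    {h h' : (J → A) → ℝ} (hh : DependsBelow lev (i + 1) h) (hh' : DependsBelow lev (i + 1) h')
    (hc : ∀ ω, ∑ x, P i (overwrite lev i ω x) * h (overwrite lev i ω x)
      = ∑ x, P i (overwrite lev i ω x) * h' (overwrite lev i ω x)) :
    ∑ ω, (∏ i, P i ω) * h ω = ∑ ω, (∏ i, P i ω) * h' ω := by
  rw [sum_truncatedLaw_eq hP i.2 hh, sum_truncatedLaw_eq hP i.2 hh']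
  have h1 : ∀ ω, truncatedLaw lev P (i + 1) ω = (∏ j ∈ Finset.univ.erase i,
      if (j : ℕ) < i + 1 then P j ω else (Fintype.card ({s // lev s = j} → A) : ℝ)⁻¹) * P i ω := by
    intro ω
    rw [truncatedLaw, ← Finset.mul_prod_erase _ _ (Finset.mem_univ i), if_pos (by simp)]
    ring
  simp_rw [h1, mul_assoc]
  refine sum_mul_eq_of_resample (lev := lev) i (fun ω x => ?_) hc
  refine Finset.prod_congr rfl fun j hj => ?_
  have hji : (j : ℕ) ≠ i := fun e => (Finset.mem_erase.1 hj).1 (Fin.ext e)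
  split_ifs with hj
  · exact (hP.dependsBelow j).overwrite_eq (by omega) ω x
  · rfl

lemma IsSequentialLaw.sum_prod_eq_one (hP : IsSequentialLaw lev P) : ∑ ω, ∏ i, P i ω = 1 := by
  have h := sum_truncatedLaw_eq hP (Nat.zero_le B) (h := fun _ => 1) fun _ _ _ => rfl
  simp only [mul_one] at h
  have hA : (Fintype.card A : ℝ) ≠ 0 := by exact_mod_cast Fintype.card_ne_zero
  have hJ : Fintype.card J = ∑ j : Fin B, Fintype.card {s // lev s = j} := by
    rw [← Fintype.card_sigma]
    exact Fintype.card_congr (Equiv.sigmaFiberEquiv lev).symm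
  rw [h]
  simp only [truncatedLaw, Nat.not_lt_zero, if_false, Finset.sum_const, Finset.card_univ,
    nsmul_eq_mul, Fintype.card_fun, Nat.cast_pow]
  rw [Finset.prod_inv_distrib, Finset.prod_pow_eq_pow_sum, hJ]
  exact mul_inv_cancel₀ (pow_ne_zero _ hA)

end

/-! ### Product weights -/

lemma overwrite_id {A : Type*} {T : ℕ} (t : Fin T) (ω : Fin T → A)
    (x : {s : Fin T // id s = t} → A) :
    overwrite id t ω x = Function.update ω t (x ⟨t, rfl⟩) := by
  funext s
  by_cases h : s = t
  · subst h; simp [overwrite]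
  · simp [overwrite, h]

section

variable {A : Type*} [Fintype A] {T : ℕ}

lemma sum_overwrite_id (t : Fin T) (ω : Fin T → A) (f : (Fin T → A) → ℝ) :
    ∑ x, f (overwrite id t ω x) = ∑ c, f (Function.update ω t c) := by
  simp_rw [overwrite_id]
  let _ : Unique {s : Fin T // id s = t} := ⟨⟨⟨t, rfl⟩⟩, fun s => Subtype.ext s.2⟩
  exact Fintype.sum_equiv (Equiv.funUnique {s : Fin T // id s = t} A) _ _ fun _ => rfl

/-- Under product weights, a factor that depends on the coordinate `t` only may be
integrated out if the rest does not depend on that coordinate. -/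
lemma sum_prod_mul_mul_eq [Nonempty A] {w : A → ℝ} (hw : ∑ c, w c = 1) (t : Fin T) (φ : A → ℝ)
    {H : (Fin T → A) → ℝ} (hH : ∀ ω c, H (Function.update ω t c) = H ω) :
    ∑ ω, (∏ s, w (ω s)) * (φ (ω t) * H ω)
      = (∑ c, w c * φ c) * ∑ ω, (∏ s, w (ω s)) * H ω := by
  have key := sum_mul_eq_of_resample (lev := id) t
    (G := fun ω => (∏ s ∈ Finset.univ.erase t, w (ω s)) * H ω)
    (F := fun ω => w (ω t) * φ (ω t)) (F' := fun ω => w (ω t) * ∑ c, w c * φ c)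
    (fun ω x => by
      rw [overwrite_id, hH]
      congr 1
      refine Finset.prod_congr rfl fun s hs => ?_
      rw [Function.update_of_ne (Finset.mem_erase.1 hs).1])
    (fun ω => by
      rw [sum_overwrite_id t ω fun ω => w (ω t) * φ (ω t),
        sum_overwrite_id t ω fun ω => w (ω t) * ∑ c, w c * φ c]
      simp [← Finset.sum_mul, hw])
  have h1 : ∀ ω : Fin T → A, ∏ s, w (ω s) = w (ω t) * ∏ s ∈ Finset.univ.erase t, w (ω s) :=
    fun ω => (Finset.mul_prod_erase _ _ (Finset.mem_univ t)).symm
  rw [Finset.mul_sum]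
  simp_rw [h1]
  convert key using 2 <;> ring

lemma sum_prod_eq_one {w : A → ℝ} (hw : ∑ c, w c = 1) :
    ∑ ω : Fin T → A, ∏ s, w (ω s) = 1 := by
  have := Finset.prod_univ_sum (fun _ : Fin T => (Finset.univ : Finset A)) fun _ c => w c
  simpa [hw] using this.symm

/-- The image of product weights under a map that acts coordinate by coordinate. -/
lemma sum_prod_mul_comp {A' : Type*} [Fintype A'] [DecidableEq A'] (w : A → ℝ)
    (f : Fin T → A → A') (Ψ : (Fin T → A') → ℝ) :
    ∑ u : Fin T → A, (∏ t, w (u t)) * Ψ (fun t => f t (u t))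
      = ∑ v : Fin T → A', (∏ t, ∑ c with f t c = v t, w c) * Ψ v := by
  rw [← Finset.sum_fiberwise Finset.univ (fun u t => f t (u t))]
  refine Finset.sum_congr rfl fun v _ => ?_
  rw [Finset.prod_univ_sum, Finset.sum_mul]
  refine Finset.sum_congr ?_ fun u hu => ?_
  · ext u
    simp [funext_iff]
  · rw [Fintype.mem_piFinset] at hu
    have : (fun t => f t (u t)) = v := funext fun t => (Finset.mem_filter.1 (hu t)).2
    rw [this]

lemma exists_le_of_le_weighted_sum {v : ℝ} {μ f : A → ℝ} (hμ : ∀ a, 0 ≤ μ a)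
    (hμ1 : ∑ a, μ a = 1) (hv : v ≤ ∑ a, μ a * f a) : ∃ a, v ≤ f a := by
  by_contra! h
  obtain ⟨a, -, ha⟩ : ∃ a ∈ Finset.univ, 0 < μ a := by
    apply Finset.exists_lt_of_sum_lt
    simp [hμ1]
  have : ∑ a, μ a * f a < ∑ a, μ a * v :=
    Finset.sum_lt_sum (fun a _ => mul_le_mul_of_nonneg_left (h a).le (hμ a))
      ⟨a, Finset.mem_univ a, mul_lt_mul_of_pos_left (h a) ha⟩
  rw [← Finset.sum_mul, hμ1] at this
  linarith

end

/-! ### Expectations under a policy -/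

namespace NonAdaptivePolicy

variable {K T B : ℕ}

/-- The expectation of `h a`, where `a` is the random list of all the arms pulled. -/
noncomputable def expect (π : NonAdaptivePolicy K T B) (r : Fin K → Fin T → ℝ)
    (h : (Fin T → Fin K) → ℝ) : ℝ :=
  ∑ a, π.prob r a * h a

lemma isSequentialLaw (π : NonAdaptivePolicy K T B) (r : Fin K → Fin T → ℝ) :
    IsSequentialLaw π.batch
      fun i a => (π.play i (π.observed r a i)).1 (fun t => a t) where
  dependsBelow i a a' h := by
    have h1 : π.observed r a i = π.observed r a' i := by
      funext s
      have := h s (by have := s.2; rw [Fin.lt_def] at this; omega)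
      simp [observed, this]
    have h2 : (fun t : {t // π.batch t = i} => a t) = fun t : {t // π.batch t = i} => a' t :=
      funext fun t => h t (by have := t.2; rw [this]; omega)
    simp only [h1, h2]
  sum_eq_one i a := by
    have h1 : ∀ x, π.observed r (overwrite π.batch i a x) i = π.observed r a i := by
      intro x
      funext s
      simp [observed, overwrite_of_ne s.2.ne]
    simp only [h1, overwrite_coe]
    exact (π.play i (π.observed r a i)).2.2

lemma prob_nonneg (π : NonAdaptivePolicy K T B) (r : Fin K → Fin T → ℝ) (a : Fin T → Fin K) :
    0 ≤ π.prob r a :=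
  Finset.prod_nonneg fun i _ => (π.play i (π.observed r a i)).2.1 _

lemma sum_prob [NeZero K] (π : NonAdaptivePolicy K T B) (r : Fin K → Fin T → ℝ) :
    ∑ a, π.prob r a = 1 :=
  (π.isSequentialLaw r).sum_prod_eq_one

lemma prob_congr (π : NonAdaptivePolicy K T B) {r r' : Fin K → Fin T → ℝ} {a : Fin T → Fin K}
    (h : ∀ t, r (a t) t = r' (a t) t) : π.prob r a = π.prob r' a := by
  have h' : ∀ i, π.observed r a i = π.observed r' a i := fun i => funext fun s => by
    simp [observed, h]
  simp [prob, h']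

/-- What is played up to batch `i` is not influenced by the rewards from batch `i` on. -/
lemma expect_congr [NeZero K] (π : NonAdaptivePolicy K T B) {r r' : Fin K → Fin T → ℝ} {i : Fin B}
    (hr : ∀ k t, π.batch t < i → r k t = r' k t) {h : (Fin T → Fin K) → ℝ}
    (hh : DependsBelow π.batch (i + 1) h) : π.expect r h = π.expect r' h := by
  refine (π.isSequentialLaw r).sum_congr (π.isSequentialLaw r') i.2 (fun j hj => ?_) hh
  funext a
  have : π.observed r a j = π.observed r' a j := by
    funext s
    simp only [observed]
    rw [hr _ _ (s.2.trans_le (Fin.le_def.2 (by omega)))]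
  rw [this]

lemma expect_mono (π : NonAdaptivePolicy K T B) (r : Fin K → Fin T → ℝ)
    {f g : (Fin T → Fin K) → ℝ} (h : ∀ a, f a ≤ g a) : π.expect r f ≤ π.expect r g :=
  Finset.sum_le_sum fun a _ => mul_le_mul_of_nonneg_left (h a) (π.prob_nonneg r a)

lemma expect_const [NeZero K] (π : NonAdaptivePolicy K T B) (r : Fin K → Fin T → ℝ) (c : ℝ) :
    π.expect r (fun _ => c) = c := by
  simp [expect, ← Finset.sum_mul, sum_prob]

lemma expect_add (π : NonAdaptivePolicy K T B) (r : Fin K → Fin T → ℝ)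
    (f g : (Fin T → Fin K) → ℝ) :
    π.expect r (fun a => f a + g a) = π.expect r f + π.expect r g := by
  simp [expect, mul_add, Finset.sum_add_distrib]

lemma expect_sub (π : NonAdaptivePolicy K T B) (r : Fin K → Fin T → ℝ)
    (f g : (Fin T → Fin K) → ℝ) :
    π.expect r (fun a => f a - g a) = π.expect r f - π.expect r g := by
  simp [expect, mul_sub, Finset.sum_sub_distrib]

lemma expect_const_mul (π : NonAdaptivePolicy K T B) (r : Fin K → Fin T → ℝ) (c : ℝ)
    (f : (Fin T → Fin K) → ℝ) : π.expect r (fun a => c * f a) = c * π.expect r f := by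
  simp only [expect, Finset.mul_sum]
  exact Finset.sum_congr rfl fun a _ => by ring

lemma expect_sum {ι : Type*} (s : Finset ι) (π : NonAdaptivePolicy K T B)
    (r : Fin K → Fin T → ℝ) (f : ι → (Fin T → Fin K) → ℝ) :
    π.expect r (fun a => ∑ j ∈ s, f j a) = ∑ j ∈ s, π.expect r (f j) := by
  simp only [expect, Finset.mul_sum]
  exact Finset.sum_comm

lemma expectedReward_eq_sum (π : NonAdaptivePolicy K T B) (r : Fin K → Fin T → ℝ) :
    π.expectedReward r = ∑ t, π.expect r (fun a => r (a t) t) :=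
  π.expect_sum Finset.univ r fun t a => r (a t) t

lemma dependsBelow_apply (π : NonAdaptivePolicy K T B) (t : Fin T) {R : Type*} (f : Fin K → R) :
    DependsBelow π.batch (π.batch t + 1) (fun a => f (a t)) :=
  fun a a' h => by simp only [h t (Nat.lt_succ_self _)]

lemma le_expectedRegret (π : NonAdaptivePolicy K T B) (r : Fin K → Fin T → ℝ) (k : Fin K) :
    ∑ t, r k t - π.expectedReward r ≤ π.expectedRegret r :=
  sub_le_sub_right (le_ciSup (Set.finite_range fun k => ∑ t, r k t).bddAbove k) _

end NonAdaptivePolicy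

lemma le_minimaxRegret {K T B : ℕ} {v : ℝ}
    (h : ∀ π : NonAdaptivePolicy K T B, ∃ r : Fin K → Fin T → ℝ,
      (∀ k t, r k t ∈ Set.Icc (0 : ℝ) 1) ∧ v ≤ π.expectedRegret r) :
    (v : EReal) ≤ minimaxRegret K T B := by
  refine le_iInf fun π => ?_
  obtain ⟨r, hr, hv⟩ := h π
  exact le_iSup₂_of_le r hr (EReal.coe_le_coe_iff.2 hv)

lemma minimaxRegret_le {K T B : ℕ} {v : ℝ} (π : NonAdaptivePolicy K T B)
    (h : ∀ r : Fin K → Fin T → ℝ, (∀ k t, r k t ∈ Set.Icc (0 : ℝ) 1) →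
      π.expectedRegret r ≤ v) :
    minimaxRegret K T B ≤ (v : EReal) :=
  iInf_le_of_le π (iSup₂_le fun r hr => EReal.coe_le_coe_iff.2 (h r hr))

/-! ### Lower bound: more arms than rounds -/

/-- Only arm `j` is rewarding, and only before round `m`: the regret is at least `m` times the
probability that a player who sees no reward at all misses this arm in these rounds, which is
estimated by a union bound. -/
lemma expectedRegret_needle {K T B m : ℕ} (π : NonAdaptivePolicy K T B) (hm : m ≤ T)
    (j : Fin K) :
    (m : ℝ) - m * π.expect 0 (fun a => ∑ t : Fin T, if (t : ℕ) < m ∧ a t = j then 1 else 0)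
      ≤ π.expectedRegret fun k t => if k = j ∧ (t : ℕ) < m then 1 else 0 := by
  have : NeZero K := ⟨by rintro rfl; exact j.elim0⟩
  set r : Fin K → Fin T → ℝ := fun k t => if k = j ∧ (t : ℕ) < m then 1 else 0 with hr
  have hcard : ∑ t : Fin T, (if (t : ℕ) < m then (1 : ℝ) else 0) = m := by
    rw [Fin.sum_univ_eq_sum_range (fun t => if t < m then (1 : ℝ) else 0), ← Finset.sum_filter,
      Finset.sum_const, nsmul_eq_mul, mul_one]
    congr 1
    have : (Finset.range T).filter (· < m) = Finset.range m := by ext; simp; omega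
    rw [this, Finset.card_range]
  have hbest : ∑ t, r j t = m := by simpa [hr] using hcard
  -- As long as arm `j` has not been pulled, all observed rewards vanish.
  have hmiss : ∀ a : Fin T → Fin K, (∀ t : Fin T, (t : ℕ) < m → a t ≠ j) →
      π.prob r a = π.prob 0 a := fun a ha =>
    π.prob_congr fun t => by
      simp only [hr, Pi.zero_apply, ite_eq_right_iff, one_ne_zero, imp_false, not_and]
      exact fun h h' => ha t h' h
  have hmiss' : π.expect r (fun a => if ∀ t : Fin T, (t : ℕ) < m → a t ≠ j then 1 else 0)
      = π.expect 0 (fun a => if ∀ t : Fin T, (t : ℕ) < m → a t ≠ j then 1 else 0) := by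
    refine Finset.sum_congr rfl fun a _ => ?_
    dsimp only
    split_ifs with h
    · rw [hmiss a h]
    · simp
  have hreward : π.expectedReward r ≤ π.expect r
      (fun a => m * (1 - if ∀ t : Fin T, (t : ℕ) < m → a t ≠ j then 1 else 0)) := by
    refine π.expect_mono r fun a => ?_
    split_ifs with h
    · refine (Finset.sum_eq_zero fun t _ => ?_).trans_le (by simp)
      simp only [hr, ite_eq_right_iff, one_ne_zero, imp_false, not_and]
      exact fun h1 h2 => h t h2 h1
    · rw [sub_zero, mul_one, ← hcard]
      refine Finset.sum_le_sum fun t _ => ?_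
      simp only [hr]
      split_ifs <;> simp_all
  have hsub := π.expect_sub 0 (fun _ => 1)
    (fun a => if ∀ t : Fin T, (t : ℕ) < m → a t ≠ j then (1 : ℝ) else 0)
  rw [π.expect_const] at hsub
  rw [π.expect_const_mul, π.expect_sub, π.expect_const, hmiss', ← hsub] at hreward
  have hunion : π.expect 0
      (fun a => 1 - if ∀ t : Fin T, (t : ℕ) < m → a t ≠ j then (1 : ℝ) else 0)
      ≤ π.expect 0 (fun a => ∑ t : Fin T, if (t : ℕ) < m ∧ a t = j then 1 else 0) := by
    refine π.expect_mono 0 fun a => ?_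
    split_ifs with h
    · rw [sub_self]
      exact Finset.sum_nonneg fun t _ => by split_ifs <;> simp
    · push Not at h
      obtain ⟨t, ht, hj⟩ := h
      calc (1 : ℝ) - 0 = if (t : ℕ) < m ∧ a t = j then 1 else 0 := by simp [hj, ht]
        _ ≤ _ := Finset.single_le_sum
          (f := fun t : Fin T => if (t : ℕ) < m ∧ a t = j then (1 : ℝ) else 0)
          (fun t _ => by split_ifs <;> simp) (Finset.mem_univ t)
  have h1 := π.le_expectedRegret r j
  have h2 := mul_le_mul_of_nonneg_left hunion (Nat.cast_nonneg m)
  rw [hbest] at h1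
  linarith

/-- With `m = ⌈T / 2⌉ ≤ K / 2`, an arm chosen uniformly at random is missed with probability at
least `1 / 2`. -/
lemma le_minimaxRegret_of_lt {K T B : ℕ} (hTK : T < K) :
    (((1 / 4 : ℝ) * T : ℝ) : EReal) ≤ minimaxRegret K T B := by
  refine le_minimaxRegret fun π => ?_
  have : NeZero K := ⟨by omega⟩
  have hK : (0 : ℝ) < K := by exact_mod_cast (show 0 < K by omega)
  set m := (T + 1) / 2 with hm
  have hmT : m ≤ T := by omega
  obtain ⟨j, hj⟩ : ∃ j : Fin K, (1 / 4 : ℝ) * T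
      ≤ π.expectedRegret fun k t => if k = j ∧ (t : ℕ) < m then 1 else 0 := by
    refine exists_le_of_le_weighted_sum (μ := fun _ => (K : ℝ)⁻¹) (fun _ => by positivity)
      (by simp [hK.ne']) ?_
    rw [← Finset.mul_sum, inv_mul_eq_div, le_div_iff₀ hK]
    refine le_trans ?_ (Finset.sum_le_sum fun j _ => expectedRegret_needle π hmT j)
    rw [Finset.sum_sub_distrib, ← Finset.mul_sum, ← π.expect_sum]
    have hcount : ∀ a : Fin T → Fin K,
        ∑ j : Fin K, ∑ t : Fin T, (if (t : ℕ) < m ∧ a t = j then (1 : ℝ) else 0) ≤ m := by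
      intro a
      rw [Finset.sum_comm]
      simp only [ite_and, Finset.sum_ite_irrel, Finset.sum_ite_eq, Finset.mem_univ, if_true,
        Finset.sum_const_zero]
      rw [← Finset.sum_filter, Finset.sum_const, nsmul_eq_mul, mul_one]
      have : (Finset.univ.filter fun t : Fin T => (t : ℕ) < m).card ≤ (Finset.range m).card :=
        Finset.card_le_card_of_injOn (fun t => (t : ℕ)) (fun t ht => by simpa using ht)
          (fun _ _ _ _ h => Fin.ext h)
      simpa using this
    have h1 := (π.expect_mono 0 hcount).trans_eq (π.expect_const 0 (m : ℝ))
    have h2 := mul_le_mul_of_nonneg_left h1 (Nat.cast_nonneg (α := ℝ) m)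
    have h3 : (2 * m : ℝ) ≤ K := by exact_mod_cast (show 2 * m ≤ K by omega)
    have h4 : (T : ℝ) ≤ 2 * m := by exact_mod_cast (show T ≤ 2 * m by omega)
    simp only [Finset.sum_const, Finset.card_univ, Fintype.card_fin, nsmul_eq_mul]
    nlinarith
  exact ⟨_, fun k t => by split_ifs <;> simp, hj⟩

/-! ### Lower bound: rewards that are constant on batches -/

/-- The sign `±1` of a Boolean. -/
def boolSign (b : Bool) : ℝ := if b then 1 else -1

@[simp] lemma boolSign_true : boolSign true = 1 := rfl

@[simp] lemma boolSign_false : boolSign false = -1 := rfl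

lemma sum_bool_fin_succ {n : ℕ} (f : (Fin (n + 1) → Bool) → ℝ) :
    ∑ σ, f σ = ∑ σ : Fin n → Bool, (f (Fin.cons true σ) + f (Fin.cons false σ)) := by
  rw [← Equiv.sum_comp (Fin.consEquiv fun _ => Bool), Fintype.sum_prod_type_right]
  simp [Fin.consEquiv]

lemma rademacher_second_moment {n : ℕ} (b : Fin n → ℝ) :
    ∑ σ : Fin n → Bool, (∑ i, boolSign (σ i) * b i) ^ 2 = 2 ^ n * ∑ i, b i ^ 2 := by
  induction n with
  | zero => simp
  | succ n ih =>
    rw [sum_bool_fin_succ]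
    simp only [Fin.sum_univ_succ, Fin.cons_zero, Fin.cons_succ, boolSign_true, boolSign_false]
    have h : ∀ σ : Fin n → Bool, (1 * b 0 + ∑ i, boolSign (σ i) * b i.succ) ^ 2
        + (-1 * b 0 + ∑ i, boolSign (σ i) * b i.succ) ^ 2
        = 2 * b 0 ^ 2 + 2 * (∑ i, boolSign (σ i) * b i.succ) ^ 2 := fun σ => by ring
    simp_rw [h]
    rw [Finset.sum_add_distrib, ← Finset.mul_sum (f := fun σ : Fin n → Bool =>
      (∑ i, boolSign (σ i) * b i.succ) ^ 2), ih fun i => b i.succ]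
    simp
    ring

lemma rademacher_fourth_moment {n : ℕ} (b : Fin n → ℝ) :
    ∑ σ : Fin n → Bool, (∑ i, boolSign (σ i) * b i) ^ 4 ≤ 3 * 2 ^ n * (∑ i, b i ^ 2) ^ 2 := by
  induction n with
  | zero => simp
  | succ n ih =>
    rw [sum_bool_fin_succ]
    simp only [Fin.sum_univ_succ, Fin.cons_zero, Fin.cons_succ, boolSign_true, boolSign_false]
    have h : ∀ σ : Fin n → Bool, (1 * b 0 + ∑ i, boolSign (σ i) * b i.succ) ^ 4
        + (-1 * b 0 + ∑ i, boolSign (σ i) * b i.succ) ^ 4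
        = 2 * b 0 ^ 4 + 12 * b 0 ^ 2 * (∑ i, boolSign (σ i) * b i.succ) ^ 2
          + 2 * (∑ i, boolSign (σ i) * b i.succ) ^ 4 := fun σ => by ring
    simp_rw [h]
    rw [Finset.sum_add_distrib, Finset.sum_add_distrib,
      ← Finset.mul_sum (f := fun σ : Fin n → Bool => (∑ i, boolSign (σ i) * b i.succ) ^ 2),
      ← Finset.mul_sum (f := fun σ : Fin n → Bool => (∑ i, boolSign (σ i) * b i.succ) ^ 4),
      rademacher_second_moment fun i => b i.succ]
    have h1 := ih fun i => b i.succ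
    have h2 : (0 : ℝ) ≤ 2 ^ n * b 0 ^ 4 := by positivity
    simp only [Finset.sum_const, Finset.card_univ, Fintype.card_fun, Fintype.card_bool,
      Fintype.card_fin, nsmul_eq_mul, Nat.cast_pow, Nat.cast_ofNat]
    ring_nf at h1 h2 ⊢
    linarith

/-- Khintchine's inequality between the first and the second moment, from the fourth moment:
`u ≥ u² - (4/27) u⁴` for `u ≥ 0`. -/
lemma rademacher_first_moment {n : ℕ} (b : Fin n → ℝ) :
    2 ^ n * (5 / 9 * √(∑ i, b i ^ 2)) ≤ ∑ σ : Fin n → Bool, |∑ i, boolSign (σ i) * b i| := by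
  set S := ∑ i, b i ^ 2 with hS
  rcases (Finset.sum_nonneg fun i _ => sq_nonneg (b i)).eq_or_lt' with h0 | hpos
  · rw [hS, h0]
    simpa using Finset.sum_nonneg fun σ _ => abs_nonneg _
  have hs : 0 < √S := Real.sqrt_pos.2 hpos
  have hsq : √S ^ 2 = S := Real.sq_sqrt hpos.le
  generalize √S = s at hs hsq ⊢
  have key : ∀ x : ℝ, x ^ 2 * S - 4 / 27 * x ^ 4 ≤ s ^ 3 * |x| := by
    intro x
    rw [← hsq, ← sq_abs x, ← Even.pow_abs (by decide : Even 4) x]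
    set u := |x|
    have hu : 0 ≤ u := abs_nonneg x
    have : 0 ≤ u * ((u - 3 / 2 * s) ^ 2 * (u + 3 * s)) := by positivity
    nlinarith
  have h := Finset.sum_le_sum fun (σ : Fin n → Bool) (_ : σ ∈ Finset.univ) =>
    key (∑ i, boolSign (σ i) * b i)
  rw [Finset.sum_sub_distrib, ← Finset.sum_mul, ← Finset.mul_sum, ← Finset.mul_sum,
    rademacher_second_moment] at h
  have h4 := rademacher_fourth_moment b
  rw [← hS] at h h4
  have h3 : 0 < s ^ 3 := by positivity
  refine le_of_mul_le_mul_left ?_ h3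
  refine le_trans ?_ h
  have : s ^ 3 * (2 ^ n * (5 / 9 * s)) = 2 ^ n * (5 / 9) * S ^ 2 := by
    rw [← hsq]; ring
  rw [this]
  nlinarith

/-- A factor `boolSign (σ i)` averages to zero against a function that does not depend on
`σ i`. -/
lemma sum_boolSign_mul_eq_zero {n : ℕ} (i : Fin n) {H : (Fin n → Bool) → ℝ}
    (hH : ∀ σ c, H (Function.update σ i c) = H σ) : ∑ σ, boolSign (σ i) * H σ = 0 := by
  have h := sum_prod_mul_mul_eq (w := fun _ : Bool => (1 / 2 : ℝ)) (by norm_num) i boolSign hH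
  have h0 : ∑ c : Bool, 1 / 2 * boolSign c = 0 := by simp
  rw [h0, zero_mul] at h
  simp only [Finset.prod_const, ← Finset.mul_sum] at h
  exact (mul_eq_zero.1 h).resolve_left (by positivity)

/-- Against independent fair signs, one for each batch, that decide whether arm `0` or all others
are rewarded, the player earns `T / 2`, and the best arm exceeds this by half the absolute value
of the signed sum of the batch lengths. -/
lemma le_minimaxRegret_batch {K T B : ℕ} (hK : 2 ≤ K) (hB : 1 ≤ B) :
    (((5 / 18 : ℝ) * (T / √B) : ℝ) : EReal) ≤ minimaxRegret K T B := by
  refine le_minimaxRegret fun π => ?_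
  have : NeZero K := ⟨by omega⟩
  let e : Fin K → ℝ := fun k => if k = 0 then 1 else -1
  let r : (Fin B → Bool) → Fin K → Fin T → ℝ :=
    fun σ k t => (1 + boolSign (σ (π.batch t)) * e k) / 2
  let X : (Fin B → Bool) → ℝ := fun σ => ∑ t, boolSign (σ (π.batch t))
  have hsum : ∀ σ k, ∑ t, r σ k t = T / 2 + e k * X σ / 2 := by
    intro σ k
    simp only [r, X, Finset.mul_sum, ← Finset.sum_div, Finset.sum_add_distrib]
    simp only [Finset.sum_const, Finset.card_univ, Fintype.card_fin, nsmul_eq_mul, mul_one]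
    rw [add_div]
    congr 2
    exact Finset.sum_congr rfl fun t _ => mul_comm _ _
  have hbest : ∀ σ, T / 2 + |X σ| / 2 - π.expectedReward (r σ) ≤ π.expectedRegret (r σ) := by
    intro σ
    have h0 := π.le_expectedRegret (r σ) 0
    have h1 := π.le_expectedRegret (r σ) ⟨1, hK⟩
    rw [hsum] at h0 h1
    have e0 : e 0 = 1 := by simp [e]
    have e1 : e ⟨1, hK⟩ = -1 := if_neg fun h => by simpa using congrArg Fin.val h
    rw [e0] at h0
    rw [e1] at h1
    rcases abs_cases (X σ) with h | h <;> rw [h.1] <;> linarith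
  -- The list of arms of a batch is drawn without any information on the sign of that batch.
  have hreward : ∑ σ, π.expectedReward (r σ) = 2 ^ B * (T / 2) := by
    simp_rw [π.expectedReward_eq_sum]
    rw [Finset.sum_comm]
    have : ∀ t, ∑ σ, π.expect (r σ) (fun a => r σ (a t) t) = 2 ^ B * (1 / 2) := by
      intro t
      have h1 : ∀ σ, π.expect (r σ) (fun a => r σ (a t) t)
          = 1 / 2 + boolSign (σ (π.batch t)) * π.expect (r σ) (fun a => e (a t)) / 2 := by
        intro σ
        have : (fun a : Fin T → Fin K => r σ (a t) t)
            = fun a => 1 / 2 + boolSign (σ (π.batch t)) / 2 * e (a t) := by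
          funext a; simp only [r]; ring
        rw [this, π.expect_add, π.expect_const, π.expect_const_mul]
        ring
      simp_rw [h1]
      rw [Finset.sum_add_distrib, ← Finset.sum_div _ fun σ : Fin B → Bool => boolSign _ * _,
        sum_boolSign_mul_eq_zero]
      · simp
      · intro σ c
        refine π.expect_congr (fun k s hs => ?_) (π.dependsBelow_apply t e)
        simp only [r]
        rw [Function.update_of_ne hs.ne]
    simp_rw [this]
    simp
    ring
  have hX : ∀ σ, X σ
      = ∑ i, boolSign (σ i) * ((Finset.univ.filter fun t => π.batch t = i).card : ℝ) := by
    intro σ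
    simp only [X]
    rw [← Finset.sum_fiberwise Finset.univ π.batch]
    refine Finset.sum_congr rfl fun i _ => ?_
    rw [Finset.sum_congr rfl fun t ht => by rw [(Finset.mem_filter.1 ht).2], Finset.sum_const,
      nsmul_eq_mul, mul_comm]
  have hkh := rademacher_first_moment fun i : Fin B =>
    ((Finset.univ.filter fun t => π.batch t = i).card : ℝ)
  simp_rw [← hX] at hkh
  have hcs : (T : ℝ) / √B
      ≤ √(∑ i : Fin B, ((Finset.univ.filter fun t => π.batch t = i).card : ℝ) ^ 2) := by
    have hT : (T : ℝ) = ∑ i : Fin B, ((Finset.univ.filter fun t => π.batch t = i).card : ℝ) := by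
      have := Finset.card_eq_sum_card_fiberwise (f := π.batch) (s := Finset.univ)
        (t := Finset.univ) fun _ _ => Finset.mem_univ _
      rw [Finset.card_univ, Fintype.card_fin] at this
      exact_mod_cast this
    have hB' : (0 : ℝ) < B := by exact_mod_cast hB
    apply Real.le_sqrt_of_sq_le
    rw [div_pow, Real.sq_sqrt hB'.le, div_le_iff₀ hB']
    have h := sq_sum_le_card_mul_sum_sq (s := Finset.univ)
      (f := fun i : Fin B => ((Finset.univ.filter fun t => π.batch t = i).card : ℝ))
    rw [← hT, Finset.card_univ, Fintype.card_fin] at h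
    linarith
  obtain ⟨σ, hσ⟩ : ∃ σ, (5 / 18 : ℝ) * (T / √B) ≤ π.expectedRegret (r σ) := by
    refine exists_le_of_le_weighted_sum (μ := fun _ => ((2 : ℝ) ^ B)⁻¹) (fun _ => by positivity)
      (by simp) ?_
    rw [← Finset.mul_sum, inv_mul_eq_div, le_div_iff₀ (by positivity)]
    refine le_trans ?_ (Finset.sum_le_sum fun σ _ => hbest σ)
    rw [Finset.sum_sub_distrib, hreward, Finset.sum_add_distrib, ← Finset.sum_div _ fun σ => |X σ|]
    simp only [Finset.sum_const, Finset.card_univ, Fintype.card_fun, Fintype.card_bool,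
      Fintype.card_fin, nsmul_eq_mul, Nat.cast_pow, Nat.cast_ofNat]
    have := mul_le_mul_of_nonneg_left hcs (show (0 : ℝ) ≤ 2 ^ B by positivity)
    linarith
  refine ⟨r σ, fun k t => ?_, hσ⟩
  simp only [r, e]
  cases σ (π.batch t) <;> split_ifs <;> norm_num

/-! ### Lower bound: one arm with a slight advantage -/

/-- The reward `0` or `1` that is encoded by a Boolean. -/
noncomputable def boolReward (b : Bool) : ℝ := (1 + boolSign b) / 2

lemma boolReward_mem_Icc (b : Bool) : boolReward b ∈ Set.Icc (0 : ℝ) 1 := by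
  cases b <;> norm_num [boolReward]

/-- The weight of a pair of independent bits, the first fair, the second of bias `ε`. -/
noncomputable def biasedWeight (ε : ℝ) (c : Bool × Bool) : ℝ := (1 + ε * boolSign c.2) / 4

lemma biasedWeight_nonneg {ε : ℝ} (hε : |ε| ≤ 1) (c : Bool × Bool) : 0 ≤ biasedWeight ε c := by
  obtain ⟨h1, h2⟩ := abs_le.1 hε
  rcases c with ⟨_, _ | _⟩ <;> simp only [biasedWeight, boolSign_true, boolSign_false] <;> linarith

lemma sum_biasedWeight (ε : ℝ) : ∑ c, biasedWeight ε c = 1 := by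
  simp [biasedWeight, Fintype.sum_prod_type]
  ring

/-- The reward sequence in which arm `j` reads the second bits and all others the first. -/
noncomputable def plantedReward {K T : ℕ} (j : Fin K) (u : Fin T → Bool × Bool) (k : Fin K)
    (t : Fin T) : ℝ :=
  boolReward (if k = j then (u t).2 else (u t).1)

/-- The reward sequence in which all arms read the same bits. -/
noncomputable def commonReward {K T : ℕ} (y : Fin T → Bool) (_ : Fin K) (t : Fin T) : ℝ :=
  boolReward (y t)

/-- The likelihood ratio of the observed rewards `y` after pulling the arms `a`: arm `j` has bias
`ε` against all arms are fair. -/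
noncomputable def likelihoodRatio {K T : ℕ} (ε : ℝ) (j : Fin K) (y : Fin T → Bool)
    (a : Fin T → Fin K) : ℝ :=
  ∏ t, if a t = j then 1 + ε * boolSign (y t) else 1

lemma one_add_mul_boolSign_pos {ε : ℝ} (hε : |ε| < 1) (b : Bool) : 0 < 1 + ε * boolSign b := by
  obtain ⟨h1, h2⟩ := abs_lt.1 hε
  cases b <;> simp only [boolSign_true, boolSign_false] <;> linarith

lemma likelihoodRatio_pos {K T : ℕ} {ε : ℝ} (hε : |ε| < 1) (j : Fin K) (y : Fin T → Bool)
    (a : Fin T → Fin K) : 0 < likelihoodRatio ε j y a :=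
  Finset.prod_pos fun t _ => by
    split_ifs
    exacts [one_add_mul_boolSign_pos hε _, one_pos]

lemma log_likelihoodRatio {K T : ℕ} {ε : ℝ} (hε : |ε| < 1) (j : Fin K) (y : Fin T → Bool)
    (a : Fin T → Fin K) : Real.log (likelihoodRatio ε j y a)
      = ∑ t, Real.log (1 + ε * boolSign (y t)) * if a t = j then 1 else 0 := by
  rw [likelihoodRatio, Real.log_prod]
  · refine Finset.sum_congr rfl fun t _ => ?_
    split_ifs <;> simp
  · intro t _
    split_ifs
    exacts [(one_add_mul_boolSign_pos hε _).ne', one_ne_zero]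

/-- Averaged over a likelihood ratio `R` of mean one, this bounds the total variation distance by
the Kullback-Leibler divergence: Pinsker's inequality with the square root linearized by the
parameter `l`. -/
lemma abs_sub_one_le_of_pos {R l : ℝ} (hR : 0 < R) (hl : 0 < l) :
    |R - 1| ≤ (R - 1 - Real.log R) / (2 * l) + l * (R + 1) := by
  obtain ⟨x, hx, rfl⟩ : ∃ x, 0 < x ∧ R = x ^ 2 :=
    ⟨√R, Real.sqrt_pos.2 hR, (Real.sq_sqrt hR.le).symm⟩
  have hlog : Real.log (x ^ 2) ≤ 2 * (x - 1) := by
    rw [Real.log_pow]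
    have := Real.log_le_sub_one_of_pos hx
    push_cast
    linarith
  have h1 : (x - 1) ^ 2 / (2 * l) ≤ (x ^ 2 - 1 - Real.log (x ^ 2)) / (2 * l) := by
    gcongr
    nlinarith
  have h2 : |x ^ 2 - 1| ≤ (x - 1) ^ 2 / (2 * l) + l / 2 * (x + 1) ^ 2 := by
    have h3 : x ^ 2 - 1 = (x - 1) * (x + 1) := by ring
    have hx1 : 0 < x + 1 := by linarith
    rw [h3, abs_mul, abs_of_pos hx1, ← sq_abs (x - 1)]
    set d := |x - 1|
    have : d ^ 2 / (2 * l) + l / 2 * (x + 1) ^ 2 - d * (x + 1)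
        = (d - l * (x + 1)) ^ 2 / (2 * l) := by
      field_simp
      ring
    have : 0 ≤ (d - l * (x + 1)) ^ 2 / (2 * l) := by positivity
    linarith
  nlinarith [mul_nonneg hl.le (sq_nonneg (x - 1))]

namespace NonAdaptivePolicy

variable {K T B : ℕ}

/-- The expectation of `F y a`, where `y` are fair bits, the rewards of all arms, and `a` are the
arms pulled. -/
noncomputable def fairExpect (π : NonAdaptivePolicy K T B)
    (F : (Fin T → Bool) → (Fin T → Fin K) → ℝ) : ℝ :=
  ∑ y, (∏ _t : Fin T, (1 / 2 : ℝ)) * π.expect (commonReward y) (F y)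

lemma fairExpect_sum {ι : Type*} (s : Finset ι) (π : NonAdaptivePolicy K T B)
    (F : ι → (Fin T → Bool) → (Fin T → Fin K) → ℝ) :
    π.fairExpect (fun y a => ∑ j ∈ s, F j y a) = ∑ j ∈ s, π.fairExpect (F j) := by
  simp only [fairExpect, expect_sum, Finset.mul_sum]
  exact Finset.sum_comm

lemma fairExpect_mono (π : NonAdaptivePolicy K T B)
    {F G : (Fin T → Bool) → (Fin T → Fin K) → ℝ} (h : ∀ y a, F y a ≤ G y a) :
    π.fairExpect F ≤ π.fairExpect G :=
  Finset.sum_le_sum fun y _ => mul_le_mul_of_nonneg_left (π.expect_mono _ (h y))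
    (Finset.prod_nonneg fun _ _ => by norm_num)

lemma fairExpect_add (π : NonAdaptivePolicy K T B)
    (F G : (Fin T → Bool) → (Fin T → Fin K) → ℝ) :
    π.fairExpect (fun y a => F y a + G y a) = π.fairExpect F + π.fairExpect G := by
  simp only [fairExpect, expect_add, mul_add, Finset.sum_add_distrib]

lemma fairExpect_const_mul (π : NonAdaptivePolicy K T B) (c : ℝ)
    (F : (Fin T → Bool) → (Fin T → Fin K) → ℝ) :
    π.fairExpect (fun y a => c * F y a) = c * π.fairExpect F := by
  simp only [fairExpect, expect_const_mul, Finset.mul_sum]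
  exact Finset.sum_congr rfl fun y _ => by ring

lemma fairExpect_one [NeZero K] (π : NonAdaptivePolicy K T B) :
    π.fairExpect (fun _ _ => 1) = 1 := by
  simp only [fairExpect, expect_const, mul_one]
  exact sum_prod_eq_one (w := fun _ : Bool => (1 / 2 : ℝ)) (by norm_num)

/-- The reward of round `t` is independent of the arm pulled in round `t`. -/
lemma fairExpect_mul_pull [NeZero K] (π : NonAdaptivePolicy K T B) (t : Fin T) (φ : Bool → ℝ)
    (f : Fin K → ℝ) :
    π.fairExpect (fun y a => φ (y t) * f (a t))
      = (φ true + φ false) / 2 * π.fairExpect (fun _ a => f (a t)) := by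
  have h := sum_prod_mul_mul_eq (w := fun _ : Bool => (1 / 2 : ℝ)) (by norm_num) t φ
    (H := fun y => π.expect (commonReward y) fun a => f (a t)) fun y c =>
      π.expect_congr (fun k s hs => by
        have : s ≠ t := by rintro rfl; exact hs.false
        simp only [commonReward, Function.update_of_ne this]) (π.dependsBelow_apply t f)
  simp only [fairExpect, expect_const_mul]
  rw [h, Fintype.sum_bool]
  ring

/-- Change of measure: only one of the two bits of a round is ever observed, so the rewards with
a planted arm may be replaced by fair common ones, weighted by the likelihood ratio. -/
lemma sum_biasedWeight_expect (π : NonAdaptivePolicy K T B) (ε : ℝ) (j : Fin K)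
    (f : (Fin T → Fin K) → ℝ) :
    ∑ u, (∏ t, biasedWeight ε (u t)) * π.expect (plantedReward j u) f
      = π.fairExpect fun y a => likelihoodRatio ε j y a * f a := by
  simp only [fairExpect, expect, Finset.mul_sum]
  rw [Finset.sum_comm, Finset.sum_comm (γ := Fin T → Bool)]
  refine Finset.sum_congr rfl fun a _ => ?_
  have h := sum_prod_mul_comp (T := T) (biasedWeight ε)
    (fun t c => if a t = j then c.2 else c.1) fun y => π.prob (commonReward y) a * f a
  have h1 : ∀ u : Fin T → Bool × Bool, π.prob (plantedReward j u) a
      = π.prob (commonReward fun t => if a t = j then (u t).2 else (u t).1) a :=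
    fun u => π.prob_congr fun t => rfl
  simp_rw [h1]
  rw [h]
  refine Finset.sum_congr rfl fun y _ => ?_
  have h2 : ∀ t, ∑ c : Bool × Bool with (if a t = j then c.2 else c.1) = y t, biasedWeight ε c
      = 1 / 2 * if a t = j then 1 + ε * boolSign (y t) else 1 := by
    intro t
    rw [Finset.sum_filter, Fintype.sum_prod_type]
    by_cases h : a t = j <;> cases y t <;> simp [h, biasedWeight] <;> ring
  simp_rw [h2]
  rw [Finset.prod_mul_distrib, likelihoodRatio]
  ring

/-- The number of pulls of arm `j`. -/
def pulls (j : Fin K) (a : Fin T → Fin K) : ℝ := ∑ t, if a t = j then 1 else 0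

lemma pulls_nonneg (j : Fin K) (a : Fin T → Fin K) : 0 ≤ pulls j a :=
  Finset.sum_nonneg fun t _ => by split_ifs <;> simp

lemma pulls_le (j : Fin K) (a : Fin T → Fin K) : pulls j a ≤ T := by
  calc pulls j a ≤ ∑ _t : Fin T, (1 : ℝ) := Finset.sum_le_sum fun t _ => by split_ifs <;> simp
    _ = T := by simp

lemma sum_pulls (a : Fin T → Fin K) : ∑ j, pulls j a = T := by
  simp only [pulls]
  rw [Finset.sum_comm]
  simp

lemma fairExpect_log_likelihoodRatio [NeZero K] (π : NonAdaptivePolicy K T B) {ε : ℝ}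
    (hε : |ε| < 1) (j : Fin K) :
    π.fairExpect (fun y a => Real.log (likelihoodRatio ε j y a))
      = Real.log (1 - ε ^ 2) / 2 * π.fairExpect fun _ a => pulls j a := by
  simp_rw [log_likelihoodRatio hε, pulls]
  rw [fairExpect_sum, fairExpect_sum, Finset.mul_sum]
  refine Finset.sum_congr rfl fun t _ => ?_
  rw [π.fairExpect_mul_pull t (fun b => Real.log (1 + ε * boolSign b))
    fun k => if k = j then 1 else 0]
  rw [← Real.log_mul (one_add_mul_boolSign_pos hε _).ne' (one_add_mul_boolSign_pos hε _).ne']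
  congr 3
  simp
  ring

/-- The advantage `ε` of arm `j` attracts few additional pulls. -/
lemma expected_pulls_le [NeZero K] (π : NonAdaptivePolicy K T B) {ε l : ℝ} (hε : ε ^ 2 ≤ 1 / 2)
    (hl : 0 < l) (j : Fin K) :
    ∑ u, (∏ t, biasedWeight ε (u t)) * π.expect (plantedReward j u) (pulls j)
      ≤ (π.fairExpect fun _ a => pulls j a)
        + T * (ε ^ 2 / (2 * l) * (π.fairExpect fun _ a => pulls j a) + 2 * l) := by
  have hε1 : |ε| < 1 := by
    rw [← sq_lt_one_iff_abs_lt_one]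
    linarith
  set M := π.fairExpect fun _ a => pulls j a with hM
  have hM0 : 0 ≤ M := by
    have := π.fairExpect_mono (F := fun _ _ => 0 * 1) (G := fun _ a => pulls j a)
      fun _ a => by simpa using pulls_nonneg j a
    rwa [fairExpect_const_mul, zero_mul] at this
  have hR1 : π.fairExpect (fun y a => likelihoodRatio ε j y a) = 1 := by
    have := π.sum_biasedWeight_expect ε j fun _ => 1
    simp only [expect_const, mul_one] at this
    rw [← this]
    exact sum_prod_eq_one (sum_biasedWeight ε)
  rw [sum_biasedWeight_expect]
  have hpt : ∀ (y : Fin T → Bool) (a : Fin T → Fin K), likelihoodRatio ε j y a * pulls j a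
      ≤ pulls j a + (T * ((1 / (2 * l) + l) * likelihoodRatio ε j y a)
        + (T * ((l - 1 / (2 * l)) * 1)
          + T * (-(1 / (2 * l)) * Real.log (likelihoodRatio ε j y a)))) := by
    intro y a
    have h := abs_sub_one_le_of_pos (likelihoodRatio_pos hε1 j y a) hl
    set R := likelihoodRatio ε j y a
    have h1 : (R - 1) * pulls j a ≤ T * |R - 1| := by
      have h2 := mul_le_mul_of_nonneg_right (le_abs_self (R - 1)) (pulls_nonneg j a)
      have h3 := mul_le_mul_of_nonneg_left (pulls_le j a) (abs_nonneg (R - 1))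
      linarith
    have h2 := mul_le_mul_of_nonneg_left h (Nat.cast_nonneg (α := ℝ) T)
    have h3 : T * ((R - 1 - Real.log R) / (2 * l) + l * (R + 1))
        = T * ((1 / (2 * l) + l) * R) + (T * ((l - 1 / (2 * l)) * 1)
          + T * (-(1 / (2 * l)) * Real.log R)) := by
      field_simp
      ring
    linarith
  refine (π.fairExpect_mono hpt).trans ?_
  simp only [fairExpect_add, fairExpect_const_mul, hR1, fairExpect_one,
    fairExpect_log_likelihoodRatio π hε1]
  rw [← hM]
  have hlog : -Real.log (1 - ε ^ 2) ≤ 2 * ε ^ 2 := by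
    have hpos : 0 < 1 - ε ^ 2 := by linarith
    have h := Real.one_sub_inv_le_log_of_pos hpos
    have h1 : (1 - ε ^ 2)⁻¹ ≤ 1 + 2 * ε ^ 2 := by
      rw [inv_le_iff_one_le_mul₀ hpos]
      nlinarith [sq_nonneg ε]
    linarith
  have h1 : -(1 / (2 * l)) * (Real.log (1 - ε ^ 2) / 2 * M) ≤ ε ^ 2 / (2 * l) * M := by
    have : 0 ≤ 1 / (2 * l) * M / 2 := by positivity
    have h2 := mul_le_mul_of_nonneg_left hlog this
    have e1 : ε ^ 2 / (2 * l) * M = 1 / (2 * l) * M / 2 * (2 * ε ^ 2) := by ring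
    rw [e1]
    linarith
  have h2 := mul_le_mul_of_nonneg_left h1 (Nat.cast_nonneg (α := ℝ) T)
  nlinarith

/-- The regret against the rewards with a planted arm, on average. -/
lemma le_average_expectedRegret [NeZero K] (π : NonAdaptivePolicy K T B) {ε : ℝ} (hε : |ε| ≤ 1)
    (j : Fin K) :
    ε / 2 * (T - ∑ u, (∏ t, biasedWeight ε (u t)) * π.expect (plantedReward j u) (pulls j))
      ≤ ∑ u, (∏ t, biasedWeight ε (u t)) * π.expectedRegret (plantedReward j u) := by
  have hw0 : ∀ u : Fin T → Bool × Bool, 0 ≤ ∏ t, biasedWeight ε (u t) :=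
    fun u => Finset.prod_nonneg fun t _ => biasedWeight_nonneg hε _
  have hw1 := sum_prod_eq_one (T := T) (sum_biasedWeight ε)
  refine le_trans (le_of_eq ?_) (Finset.sum_le_sum fun u _ =>
    mul_le_mul_of_nonneg_left (π.le_expectedRegret (plantedReward j u) j) (hw0 u))
  -- In each round, the regret is the bias of arm `j`, unless this arm is pulled.
  have hround : ∀ (u : Fin T → Bool × Bool) (t : Fin T),
      plantedReward j u j t - π.expect (plantedReward j u) (fun a => plantedReward j u (a t) t)
        = (boolReward (u t).2 - boolReward (u t).1)
          * π.expect (plantedReward j u) (fun a => 1 - if a t = j then 1 else 0) := by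
    intro u t
    rw [← π.expect_const (plantedReward j u) (plantedReward j u j t), ← expect_sub,
      ← expect_const_mul]
    refine congrArg _ (funext fun a => ?_)
    by_cases h : a t = j <;> simp [plantedReward, h]
  have hind : ∀ t : Fin T, ∑ u, (∏ s, biasedWeight ε (u s))
      * ((boolReward (u t).2 - boolReward (u t).1)
          * π.expect (plantedReward j u) (fun a => 1 - if a t = j then 1 else 0))
      = ε / 2 * ∑ u, (∏ s, biasedWeight ε (u s))
          * π.expect (plantedReward j u) (fun a => 1 - if a t = j then 1 else 0) := by
    intro t
    rw [sum_prod_mul_mul_eq (sum_biasedWeight ε) t (fun c => boolReward c.2 - boolReward c.1)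
      (H := fun u => π.expect (plantedReward j u) (fun a => 1 - if a t = j then 1 else 0))]
    · congr 1
      simp [Fintype.sum_prod_type, biasedWeight, boolReward]
      ring
    · intro u c
      refine π.expect_congr (fun k s hs => ?_)
        (π.dependsBelow_apply t fun k => 1 - if k = j then (1 : ℝ) else 0)
      have : s ≠ t := by rintro rfl; exact hs.false
      simp only [plantedReward, Function.update_of_ne this]
  simp_rw [expectedReward_eq_sum, ← Finset.sum_sub_distrib, hround, Finset.mul_sum]
  rw [Finset.sum_comm]
  simp_rw [hind, ← Finset.mul_sum]
  rw [Finset.sum_comm]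
  simp_rw [← Finset.mul_sum, ← expect_sum, Finset.sum_sub_distrib, expect_sub, expect_const,
    mul_sub, Finset.sum_sub_distrib, ← Finset.sum_mul, hw1]
  have hp : pulls (T := T) j = fun a => ∑ t, if a t = j then 1 else 0 := rfl
  rw [hp]
  simp only [Finset.sum_const, Finset.card_univ, Fintype.card_fin, nsmul_eq_mul, mul_one, one_mul]
  ring

end NonAdaptivePolicy

open NonAdaptivePolicy in
/-- The advantage `ε = √(K / T) / 8` is too small for finding the planted arm: for some `j`, it is
pulled at most `3 T / 4` times on average. -/
lemma le_minimaxRegret_sqrt {K T B : ℕ} (hK : 2 ≤ K) (hKT : K ≤ T) :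
    (((1 / 64 : ℝ) * √(K * T) : ℝ) : EReal) ≤ minimaxRegret K T B := by
  refine le_minimaxRegret fun π => ?_
  have : NeZero K := ⟨by omega⟩
  have hK0 : (2 : ℝ) ≤ K := by exact_mod_cast hK
  have hKT' : (K : ℝ) ≤ T := by exact_mod_cast hKT
  have hT0 : (0 : ℝ) < T := by linarith
  set ε : ℝ := √(K * T) / (8 * T) with hε
  have hε0 : 0 ≤ ε := by positivity
  have hεsq : ε ^ 2 = K / (64 * T) := by
    rw [hε, div_pow, Real.sq_sqrt (by positivity)]
    field_simp
    norm_num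
  have hε2 : ε ^ 2 ≤ 1 / 64 := by
    rw [hεsq, div_le_iff₀ (by positivity)]
    linarith
  have hε1 : |ε| ≤ 1 := by
    rw [← sq_le_one_iff_abs_le_one]
    linarith
  have hsum : ∑ j : Fin K, π.fairExpect (fun _ a => pulls j a) = T := by
    rw [← π.fairExpect_sum]
    simp only [sum_pulls]
    have := π.fairExpect_const_mul T fun _ _ => 1
    simpa [fairExpect_one] using this
  obtain ⟨j, hj⟩ : ∃ j : Fin K, (T : ℝ) / 4 ≤ T - ∑ u,
      (∏ t, biasedWeight ε (u t)) * π.expect (plantedReward j u) (pulls j) := by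
    refine exists_le_of_le_weighted_sum (μ := fun _ => (K : ℝ)⁻¹) (fun _ => by positivity)
      (by simp) ?_
    rw [← Finset.mul_sum, inv_mul_eq_div, le_div_iff₀ (by positivity), Finset.sum_sub_distrib]
    -- `l = 1 / 16` minimizes the bound, since `ε² T / K = 1 / 64`.
    have h := Finset.sum_le_sum fun (j : Fin K) (_ : j ∈ Finset.univ) =>
      π.expected_pulls_le (ε := ε) (l := 1 / 16) (by linarith) (by norm_num) j
    rw [Finset.sum_add_distrib, ← Finset.mul_sum, Finset.sum_add_distrib, ← Finset.mul_sum, hsum,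
      hεsq] at h
    simp only [Finset.sum_const, Finset.card_univ, Fintype.card_fin, nsmul_eq_mul] at h ⊢
    have e : (T : ℝ) * (K / (64 * T) / (2 * (1 / 16)) * T + K * (2 * (1 / 16)))
        = K * T / 4 := by
      field_simp
      norm_num
    rw [e] at h
    nlinarith
  have hw1 := sum_prod_eq_one (T := T) (sum_biasedWeight ε)
  have h := mul_le_mul_of_nonneg_left hj (div_nonneg hε0 zero_le_two)
  have hav := π.le_average_expectedRegret hε1 j
  obtain ⟨u, hu⟩ : ∃ u : Fin T → Bool × Bool,
      1 / 64 * √(K * T) ≤ π.expectedRegret (plantedReward j u) := by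
    refine exists_le_of_le_weighted_sum
      (μ := fun u : Fin T → Bool × Bool => ∏ t, biasedWeight ε (u t))
      (f := fun u : Fin T → Bool × Bool => π.expectedRegret (plantedReward j u))
      (fun u => Finset.prod_nonneg fun t _ => biasedWeight_nonneg hε1 _) hw1 ?_
    refine le_trans (le_of_eq ?_) (h.trans hav)
    rw [hε]
    field_simp
    norm_num
  exact ⟨plantedReward j u, fun k t => boolReward_mem_Icc _, hu⟩

/-! ### Exponential weights -/

/-- The exponential weights `exp (-η L k)`, normalized to a probability distribution. -/
noncomputable def expWeights {K : ℕ} (η : ℝ) (L : Fin K → ℝ) (k : Fin K) : ℝ :=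
  Real.exp (-(η * L k)) / ∑ j, Real.exp (-(η * L j))

lemma sum_exp_pos {K : ℕ} [NeZero K] (L : Fin K → ℝ) : 0 < ∑ j, Real.exp (L j) :=
  Finset.sum_pos (fun _ _ => Real.exp_pos _) Finset.univ_nonempty

lemma expWeights_pos {K : ℕ} [NeZero K] (η : ℝ) (L : Fin K → ℝ) (k : Fin K) :
    0 < expWeights η L k :=
  div_pos (Real.exp_pos _) (sum_exp_pos _)

lemma sum_expWeights {K : ℕ} [NeZero K] (η : ℝ) (L : Fin K → ℝ) :
    ∑ k, expWeights η L k = 1 := by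
  simp only [expWeights, ← Finset.sum_div]
  exact div_self (sum_exp_pos _).ne'

lemma exp_neg_le_quadratic {x : ℝ} (hx : 0 ≤ x) : Real.exp (-x) ≤ 1 - x + x ^ 2 / 2 := by
  rw [Real.exp_neg]
  have h := Real.quadratic_le_exp_of_nonneg hx
  have h1 : 0 < 1 - x + x ^ 2 / 2 := by nlinarith [sq_nonneg (x - 1)]
  rw [inv_le_iff_one_le_mul₀ (Real.exp_pos x)]
  nlinarith [mul_le_mul_of_nonneg_left h h1.le, sq_nonneg (x ^ 2)]

/-- The second-order regret bound of exponential weights, for nonnegative losses `c`. The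
potential is the logarithm of the sum of the weights. -/
lemma expWeights_regret {K : ℕ} [NeZero K] {η : ℝ} (hη : 0 < η) {c : ℕ → Fin K → ℝ}
    (hc : ∀ i k, 0 ≤ c i k) (n : ℕ) (k : Fin K) :
    ∑ i ∈ Finset.range n, ∑ j, expWeights η (fun j => ∑ l ∈ Finset.range i, c l j) j * c i j
      ≤ ∑ i ∈ Finset.range n, c i k + (Real.log K / η + η / 2 * ∑ i ∈ Finset.range n,
        ∑ j, expWeights η (fun j => ∑ l ∈ Finset.range i, c l j) j * c i j ^ 2) := by
  set L : ℕ → Fin K → ℝ := fun i j => ∑ l ∈ Finset.range i, c l j with hL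
  let W : ℕ → ℝ := fun i => ∑ j, Real.exp (-(η * L i j))
  have hW : ∀ i, 0 < W i := fun i => sum_exp_pos _
  have hstep : ∀ i, Real.log (W (i + 1)) ≤ Real.log (W i)
      + (-(η * ∑ j, expWeights η (L i) j * c i j)
        + η ^ 2 / 2 * ∑ j, expWeights η (L i) j * c i j ^ 2) := by
    intro i
    have h1 : W (i + 1) / W i = ∑ j, expWeights η (L i) j * Real.exp (-(η * c i j)) := by
      simp only [W, Finset.sum_div]
      refine Finset.sum_congr rfl fun j _ => ?_
      rw [expWeights, div_mul_eq_mul_div, ← Real.exp_add]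
      congr 2
      simp only [hL, Finset.sum_range_succ]
      ring
    have h2 : W (i + 1) / W i ≤ 1 + (-(η * ∑ j, expWeights η (L i) j * c i j)
        + η ^ 2 / 2 * ∑ j, expWeights η (L i) j * c i j ^ 2) := by
      rw [h1, ← sum_expWeights η (L i), Finset.mul_sum, Finset.mul_sum, ← Finset.sum_neg_distrib,
        ← Finset.sum_add_distrib, ← Finset.sum_add_distrib]
      refine Finset.sum_le_sum fun j _ => ?_
      have := mul_le_mul_of_nonneg_left (exp_neg_le_quadratic (mul_nonneg hη.le (hc i j)))
        (expWeights_pos η (L i) j).le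
      refine this.trans_eq ?_
      ring
    have h3 := Real.log_le_sub_one_of_pos (div_pos (hW (i + 1)) (hW i))
    rw [Real.log_div (hW _).ne' (hW _).ne'] at h3
    linarith
  have htotal : Real.log (W n) ≤ Real.log K
      + ∑ i ∈ Finset.range n, (-(η * ∑ j, expWeights η (L i) j * c i j)
        + η ^ 2 / 2 * ∑ j, expWeights η (L i) j * c i j ^ 2) := by
    induction n with
    | zero => simp [W, hL]
    | succ n ih =>
      rw [Finset.sum_range_succ]
      linarith [hstep n]
  have hk : -(η * ∑ i ∈ Finset.range n, c i k) ≤ Real.log (W n) := by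
    rw [Real.le_log_iff_exp_le (hW n)]
    exact Finset.single_le_sum (f := fun j => Real.exp (-(η * L n j)))
      (fun _ _ => (Real.exp_pos _).le) (Finset.mem_univ k)
  rw [Finset.sum_add_distrib, Finset.sum_neg_distrib, ← Finset.mul_sum, ← Finset.mul_sum]
    at htotal
  refine le_of_mul_le_mul_left ?_ hη
  have e : η * (Real.log K / η) = Real.log K := by field_simp
  rw [mul_add, mul_add, e]
  nlinarith

/-! ### The batched exponential-weights policy -/

section

variable {K T : ℕ}

/-- The rounds of batch `i`, if batches have length `b`. -/
def batchRounds (T b i : ℕ) : Finset (Fin T) := Finset.univ.filter fun t => (t : ℕ) / b = i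

lemma mem_batchRounds {T b i : ℕ} {t : Fin T} : t ∈ batchRounds T b i ↔ (t : ℕ) / b = i := by
  simp [batchRounds]

/-- The estimated total losses of the arms before batch `i`, with batches of length `b`, from the
history `h` of arms and rewards. The loss `1 - reward` of the arm pulled is divided by the
probability of pulling it, which is the same in all rounds of a batch. -/
noncomputable def lossEstimate (η : ℝ) (b : ℕ) : ℕ → (Fin T → Fin K × ℝ) → Fin K → ℝ
  | 0, _, _ => 0
  | i + 1, h, k => lossEstimate η b i h k + ∑ t ∈ batchRounds T b i,
      if (h t).1 = k then (1 - (h t).2) / expWeights η (lossEstimate η b i h) k else 0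

lemma lossEstimate_congr (η : ℝ) (b : ℕ) {i : ℕ} {h h' : Fin T → Fin K × ℝ}
    (hh : ∀ t : Fin T, (t : ℕ) / b < i → h t = h' t) :
    lossEstimate η b i h = lossEstimate η b i h' := by
  induction i with
  | zero => rfl
  | succ i ih =>
    have ih' := ih fun t ht => hh t (ht.trans (Nat.lt_succ_self i))
    funext k
    simp only [lossEstimate, ih']
    congr 1
    refine Finset.sum_congr rfl fun t ht => ?_
    have := mem_batchRounds.1 ht
    rw [hh t (by omega)]

/-- Batched exponential weights: batches of length `b`, in each of which the arms are drawn
independently from the exponential weights of the losses estimated before. -/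
noncomputable def batchedExpWeights (K T B : ℕ) [NeZero K] (η : ℝ) (b : ℕ) (hb : T ≤ b * B) :
    NonAdaptivePolicy K T B where
  batch t := ⟨t / b, Nat.div_lt_of_lt_mul (t.2.trans_le hb)⟩
  batch_mono s t hst := Fin.le_def.2 (Nat.div_le_div_right hst)
  play i h := ⟨fun x => ∏ t, expWeights η (lossEstimate η b i
      fun s => if hs : (⟨s / b, Nat.div_lt_of_lt_mul (s.2.trans_le hb)⟩ : Fin B) < i
        then h ⟨s, hs⟩ else (0, 0)) (x t),
    fun x => Finset.prod_nonneg fun t _ => (expWeights_pos _ _ _).le, by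
      have := Finset.prod_univ_sum
        (fun _ : {t : Fin T // (⟨t / b, Nat.div_lt_of_lt_mul (t.2.trans_le hb)⟩ : Fin B) = i} =>
          (Finset.univ : Finset (Fin K))) fun _ k => expWeights η (lossEstimate η b i
        fun s => if hs : (⟨s / b, Nat.div_lt_of_lt_mul (s.2.trans_le hb)⟩ : Fin B) < i
          then h ⟨s, hs⟩ else (0, 0)) k
      simpa [sum_expWeights] using this.symm⟩

/-- The distribution from which the arms of batch `i` are drawn, if the arms `a` have been
pulled. -/
noncomputable def armLaw (η : ℝ) (b : ℕ) (r : Fin K → Fin T → ℝ) (i : ℕ) (a : Fin T → Fin K) :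
    Fin K → ℝ :=
  expWeights η (lossEstimate η b i fun s => (a s, r (a s) s))

lemma armLaw_pos [NeZero K] (η : ℝ) (b : ℕ) (r : Fin K → Fin T → ℝ) (i : ℕ) (a : Fin T → Fin K)
    (k : Fin K) : 0 < armLaw η b r i a k :=
  expWeights_pos _ _ _

lemma sum_armLaw [NeZero K] (η : ℝ) (b : ℕ) (r : Fin K → Fin T → ℝ) (i : ℕ)
    (a : Fin T → Fin K) : ∑ k, armLaw η b r i a k = 1 :=
  sum_expWeights _ _

lemma dependsBelow_armLaw (η : ℝ) (b : ℕ) (r : Fin K → Fin T → ℝ) {i m : ℕ}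
    (hm : ∀ s : ℕ, s / b < i → s < m) : DependsBelow (id : Fin T → Fin T) m (armLaw η b r i) :=
  fun a a' h => by
    simp only [armLaw]
    rw [lossEstimate_congr η b fun t ht => by rw [h t (hm t ht)]]

lemma lt_of_div_lt_div {b s t : ℕ} (h : s / b < t / b) : s < t := by
  by_contra! hts
  exact absurd (Nat.div_le_div_right hts) (not_le.2 h)

lemma prob_batchedExpWeights {B : ℕ} [NeZero K] (η : ℝ) {b : ℕ} (hb : T ≤ b * B)
    (r : Fin K → Fin T → ℝ) (a : Fin T → Fin K) :
    (batchedExpWeights K T B η b hb).prob r a = ∏ t : Fin T, armLaw η b r (t / b) a (a t) := by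
  rw [NonAdaptivePolicy.prob, ← Fintype.prod_fiberwise (batchedExpWeights K T B η b hb).batch]
  refine Finset.prod_congr rfl fun i _ => ?_
  change ∏ t : {t // (batchedExpWeights K T B η b hb).batch t = i}, expWeights η
    (lossEstimate η b i fun s =>
      if _ : (⟨s / b, Nat.div_lt_of_lt_mul (s.2.trans_le hb)⟩ : Fin B) < i then
        (a s, r (a s) s) else (0, 0)) (a t) = _
  refine Finset.prod_congr rfl fun t _ => ?_
  have ht : (t : ℕ) / b = i := congrArg Fin.val t.2
  rw [ht, armLaw]
  have e : (lossEstimate η b i fun s =>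
      if _ : (⟨s / b, Nat.div_lt_of_lt_mul (s.2.trans_le hb)⟩ : Fin B) < i
        then (a s, r (a s) s) else (0, 0)) = lossEstimate η b i fun s => (a s, r (a s) s) :=
    lossEstimate_congr η b fun s hs => dif_pos (Fin.lt_def.2 hs)
  rw [e]

lemma isSequentialLaw_armLaw [NeZero K] (η : ℝ) (b : ℕ) (r : Fin K → Fin T → ℝ) :
    IsSequentialLaw (id : Fin T → Fin T) fun t a => armLaw η b r (t / b) a (a t) where
  dependsBelow t a a' h := by
    have h1 : armLaw η b r (t / b) a = armLaw η b r (t / b) a' :=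
      dependsBelow_armLaw η b r (fun _ hs => (lt_of_div_lt_div hs).trans (Nat.lt_succ_self _))
        a a' h
    simp only [h1, h t (Nat.lt_succ_self _)]
  sum_eq_one t a := by
    rw [sum_overwrite_id t a fun a => armLaw η b r (t / b) a (a t)]
    have h1 : ∀ c, armLaw η b r (t / b) (Function.update a t c) = armLaw η b r (t / b) a := by
      intro c
      refine dependsBelow_armLaw η b r (m := t) (fun _ => lt_of_div_lt_div) _ _ fun s hs => ?_
      rw [Function.update_of_ne (by rintro rfl; exact hs.false)]
    simp only [h1, Function.update_self, sum_armLaw]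

/-- The conditional expectation given the rounds before `t`. -/
lemma expect_batchedExpWeights {B : ℕ} [NeZero K] (η : ℝ) {b : ℕ} (hb : T ≤ b * B)
    (r : Fin K → Fin T → ℝ) (t : Fin T) {ψ : (Fin T → Fin K) → Fin K → ℝ}
    (hψ : DependsBelow (id : Fin T → Fin T) t ψ) :
    (batchedExpWeights K T B η b hb).expect r (fun a => ψ a (a t))
      = (batchedExpWeights K T B η b hb).expect r
          fun a => ∑ c, armLaw η b r (t / b) a c * ψ a c := by
  simp only [NonAdaptivePolicy.expect, prob_batchedExpWeights]
  have hq := dependsBelow_armLaw (T := T) η b r (i := t / b) (m := t) fun _ => lt_of_div_lt_div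
  have hupd : ∀ (a : Fin T → Fin K) (c : Fin K) (s : Fin T), ((id s : Fin T) : ℕ) < t →
      Function.update a t c s = a s :=
    fun a c s hs => by rw [Function.update_of_ne]; rintro rfl; exact hs.false
  refine (isSequentialLaw_armLaw η b r).sum_eq_of_conditional t ?_ ?_ ?_
  · intro a a' h
    have h1 : ψ a = ψ a' := hψ.mono (Nat.le_succ _) a a' h
    simp only [h1, h t (Nat.lt_succ_self _)]
  · intro a a' h
    have h1 : ψ a = ψ a' := hψ.mono (Nat.le_succ _) a a' h
    have h2 := hq.mono (Nat.le_succ _) a a' h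
    simp only [h1, h2]
  · intro a
    rw [sum_overwrite_id t a fun a => armLaw η b r (t / b) a (a t) * ψ a (a t),
      sum_overwrite_id t a fun a => armLaw η b r (t / b) a (a t)
        * ∑ c, armLaw η b r (t / b) a c * ψ a c]
    have h1 : ∀ c, armLaw η b r (t / b) (Function.update a t c) = armLaw η b r (t / b) a :=
      fun c => hq _ _ fun s hs => hupd a c s hs
    have h2 : ∀ c, ψ (Function.update a t c) = ψ a := fun c => hψ _ _ fun s hs => hupd a c s hs
    simp only [h1, h2, Function.update_self, ← Finset.sum_mul, sum_armLaw, one_mul]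

/-- The importance-weighted estimate of the loss of arm `k` in round `t`. -/
noncomputable def roundEstimate (η : ℝ) (b : ℕ) (r : Fin K → Fin T → ℝ) (k : Fin K) (t : Fin T)
    (a : Fin T → Fin K) : ℝ :=
  if a t = k then (1 - r k t) / armLaw η b r (t / b) a k else 0

lemma lossEstimate_eq_sum (η : ℝ) (b : ℕ) (r : Fin K → Fin T → ℝ) (i : ℕ) (a : Fin T → Fin K)
    (k : Fin K) : lossEstimate η b i (fun s => (a s, r (a s) s)) k
      = ∑ l ∈ Finset.range i, ∑ t ∈ batchRounds T b l, roundEstimate η b r k t a := by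
  induction i with
  | zero => simp [lossEstimate]
  | succ i ih =>
    rw [Finset.sum_range_succ, ← ih, lossEstimate]
    congr 1
    refine Finset.sum_congr rfl fun t ht => ?_
    have hti : (t : ℕ) / b = i := mem_batchRounds.1 ht
    rw [roundEstimate, armLaw, hti]
    split_ifs with h
    · obtain rfl : a t = k := h
      rfl
    · rfl

lemma dependsBelow_roundEstimate (η : ℝ) (b : ℕ) (r : Fin K → Fin T → ℝ) (k : Fin K)
    (t : Fin T) : DependsBelow (id : Fin T → Fin T) (t + 1) (roundEstimate η b r k t) :=
  fun a a' h => by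
    have h1 : armLaw η b r (t / b) a = armLaw η b r (t / b) a' :=
      dependsBelow_armLaw η b r (fun _ hs => (lt_of_div_lt_div hs).trans (Nat.lt_succ_self _))
        a a' h
    simp only [roundEstimate, h1, h t (Nat.lt_succ_self _)]

lemma sum_armLaw_mul_roundEstimate [NeZero K] (η : ℝ) (b : ℕ) (r : Fin K → Fin T → ℝ)
    (t : Fin T) (a : Fin T → Fin K) :
    ∑ k, armLaw η b r (t / b) a k * roundEstimate η b r k t a = 1 - r (a t) t := by
  simp only [roundEstimate, mul_ite, mul_zero, Finset.sum_ite_eq, Finset.mem_univ, if_true]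
  exact mul_div_cancel₀ _ (armLaw_pos η b r _ a _).ne'

variable {B : ℕ} [NeZero K] (η : ℝ) {b : ℕ} (hb : T ≤ b * B) (r : Fin K → Fin T → ℝ)

/-- The estimates are conditionally unbiased. -/
lemma expect_mul_roundEstimate (k : Fin K) (t : Fin T) {φ : (Fin T → Fin K) → ℝ}
    (hφ : DependsBelow (id : Fin T → Fin T) t φ) :
    (batchedExpWeights K T B η b hb).expect r (fun a => φ a * roundEstimate η b r k t a)
      = (1 - r k t) * (batchedExpWeights K T B η b hb).expect r φ := by
  have hq := dependsBelow_armLaw (T := T) η b r (i := t / b) (m := t) fun _ => lt_of_div_lt_div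
  have h := expect_batchedExpWeights η hb r t
    (ψ := fun a c => φ a * if c = k then (1 - r k t) / armLaw η b r (t / b) a k else 0)
    fun a a' h => by simp only [hφ a a' h, hq a a' h]
  simp only [roundEstimate]
  rw [h, ← NonAdaptivePolicy.expect_const_mul]
  refine congrArg _ (funext fun a => ?_)
  simp only [mul_ite, mul_zero, Finset.sum_ite_eq', Finset.mem_univ, if_true]
  have := (armLaw_pos η b r (t / b) a k).ne'
  field_simp

lemma expect_armLaw_nonneg (i : ℕ) (k : Fin K) :
    0 ≤ (batchedExpWeights K T B η b hb).expect r fun a => armLaw η b r i a k :=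
  Finset.sum_nonneg fun a _ =>
    mul_nonneg (NonAdaptivePolicy.prob_nonneg _ r a) (armLaw_pos η b r i a k).le

variable {r} (hr : ∀ k t, r k t ∈ Set.Icc (0 : ℝ) 1)

include hr

lemma expect_armLaw_mul_sq_le (k : Fin K) (t : Fin T) :
    (batchedExpWeights K T B η b hb).expect r (fun a => armLaw η b r (t / b) a k *
      (roundEstimate η b r k t a * roundEstimate η b r k t a)) ≤ 1 := by
  have hq := dependsBelow_armLaw (T := T) η b r (i := t / b) (m := t) fun _ => lt_of_div_lt_div
  have h := expect_batchedExpWeights η hb r t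
    (ψ := fun a c => armLaw η b r (t / b) a k *
      ((if c = k then (1 - r k t) / armLaw η b r (t / b) a k else 0) *
        if c = k then (1 - r k t) / armLaw η b r (t / b) a k else 0))
    fun a a' h => by simp only [hq a a' h]
  simp only [roundEstimate]
  rw [h]
  refine (NonAdaptivePolicy.expect_mono _ _ (g := fun _ => 1) fun a => ?_).trans_eq
    (NonAdaptivePolicy.expect_const _ r 1)
  simp only [mul_ite, mul_zero, ite_mul, zero_mul, Finset.sum_ite_eq', Finset.mem_univ, if_true]
  have h0 := armLaw_pos η b r (t / b) a k
  have e : armLaw η b r (t / b) a k * (armLaw η b r (t / b) a k *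
      ((1 - r k t) / armLaw η b r (t / b) a k * ((1 - r k t) / armLaw η b r (t / b) a k)))
      = (1 - r k t) ^ 2 := by
    field_simp
  obtain ⟨h1, h2⟩ := hr k t
  rw [e]
  nlinarith

lemma expect_armLaw_mul_mul_le_of_lt (k : Fin K) {s t : Fin T} (hst : (s : ℕ) / b = t / b)
    (hlt : s < t) :
    (batchedExpWeights K T B η b hb).expect r (fun a => armLaw η b r (t / b) a k *
      (roundEstimate η b r k s a * roundEstimate η b r k t a))
      ≤ (batchedExpWeights K T B η b hb).expect r fun a => armLaw η b r (t / b) a k := by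
  have hq := dependsBelow_armLaw (T := T) η b r (i := t / b) (m := s)
    fun u hu => lt_of_div_lt_div (hst ▸ hu)
  have hq' : DependsBelow (id : Fin T → Fin T) s fun a => armLaw η b r (t / b) a k :=
    fun a a' h => congrFun (hq a a' h) k
  have h1 := expect_mul_roundEstimate η hb r k t
    (φ := fun a => armLaw η b r (t / b) a k * roundEstimate η b r k s a) fun a a' h =>
      congrArg₂ (· * ·) (hq'.mono hlt.le a a' h)
        ((dependsBelow_roundEstimate η b r k s).mono hlt a a' h)
  simp only [← mul_assoc]
  rw [h1, expect_mul_roundEstimate η hb r k s hq', ← mul_assoc]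
  obtain ⟨hs0, hs1⟩ := hr k s
  obtain ⟨ht0, ht1⟩ := hr k t
  refine mul_le_of_le_one_left (expect_armLaw_nonneg η hb r _ k) ?_
  exact mul_le_one₀ (by linarith) (by linarith) (by linarith)

lemma expect_armLaw_mul_mul_le (k : Fin K) {i : ℕ} {s t : Fin T} (hs : (s : ℕ) / b = i)
    (ht : (t : ℕ) / b = i) :
    (batchedExpWeights K T B η b hb).expect r (fun a => armLaw η b r i a k *
      (roundEstimate η b r k s a * roundEstimate η b r k t a))
      ≤ (if s = t then 1 else 0)
        + (batchedExpWeights K T B η b hb).expect r fun a => armLaw η b r i a k := by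
  rcases lt_trichotomy s t with h | h | h
  · subst ht
    rw [if_neg h.ne, zero_add]
    exact expect_armLaw_mul_mul_le_of_lt η hb hr k hs h
  · subst h ht
    rw [if_pos rfl]
    linarith [expect_armLaw_mul_sq_le η hb hr k s, expect_armLaw_nonneg η hb r (s / b) k]
  · subst hs
    rw [if_neg h.ne', zero_add]
    simp_rw [mul_comm (roundEstimate η b r k s _)]
    exact expect_armLaw_mul_mul_le_of_lt η hb hr k ht h

/-- Within a batch of at most `b` rounds, the second moment of the estimates is at most `K + b`
per round: the cross terms contribute `b`, the squares `K`. -/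
lemma expect_sum_armLaw_mul_sq_le (i : ℕ) (hi : (batchRounds T b i).card ≤ b) :
    (batchedExpWeights K T B η b hb).expect r (fun a => ∑ k, armLaw η b r i a k *
      (∑ t ∈ batchRounds T b i, roundEstimate η b r k t a) ^ 2)
      ≤ (batchRounds T b i).card * (K + b) := by
  have h1 : ∀ k, (batchedExpWeights K T B η b hb).expect r (fun a => armLaw η b r i a k *
      (∑ t ∈ batchRounds T b i, roundEstimate η b r k t a) ^ 2)
      ≤ (batchRounds T b i).card + (batchRounds T b i).card ^ 2
        * (batchedExpWeights K T B η b hb).expect r fun a => armLaw η b r i a k := by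
    intro k
    have e : (fun a => armLaw η b r i a k *
        (∑ t ∈ batchRounds T b i, roundEstimate η b r k t a) ^ 2)
        = fun a => ∑ s ∈ batchRounds T b i, ∑ t ∈ batchRounds T b i, armLaw η b r i a k *
          (roundEstimate η b r k s a * roundEstimate η b r k t a) := by
      funext a
      rw [sq, Finset.sum_mul_sum, Finset.mul_sum]
      simp_rw [Finset.mul_sum]
    rw [e, NonAdaptivePolicy.expect_sum]
    simp_rw [NonAdaptivePolicy.expect_sum]
    refine (Finset.sum_le_sum fun s hs => Finset.sum_le_sum fun t ht =>
      expect_armLaw_mul_mul_le η hb hr k (mem_batchRounds.1 hs)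
        (mem_batchRounds.1 ht)).trans_eq ?_
    simp only [Finset.sum_add_distrib, Finset.sum_ite_eq, Finset.sum_const, nsmul_eq_mul,
      Finset.sum_ite_mem, Finset.inter_self, mul_one]
    ring
  rw [NonAdaptivePolicy.expect_sum]
  refine (Finset.sum_le_sum fun k _ => h1 k).trans ?_
  rw [Finset.sum_add_distrib, ← Finset.mul_sum, ← NonAdaptivePolicy.expect_sum]
  simp only [sum_armLaw, NonAdaptivePolicy.expect_const, Finset.sum_const, Finset.card_univ,
    Fintype.card_fin, nsmul_eq_mul, mul_one]
  have : ((batchRounds T b i).card : ℝ) ≤ b := by exact_mod_cast hi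
  nlinarith [Nat.cast_nonneg (α := ℝ) (batchRounds T b i).card]

omit hr [NeZero K] in
lemma card_batchRounds_le (hb0 : 0 < b) (i : ℕ) : (batchRounds T b i).card ≤ b := by
  calc (batchRounds T b i).card ≤ (Finset.Ico (i * b) (i * b + b)).card := by
        refine Finset.card_le_card_of_injOn (fun t => (t : ℕ)) (fun t ht => ?_)
          (fun _ _ _ _ h => Fin.ext h)
        have hti : (t : ℕ) / b = i := mem_batchRounds.1 ht
        have h1 := Nat.div_mul_le_self (t : ℕ) b
        have h2 := Nat.lt_div_mul_add hb0 (a := t)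
        rw [hti] at h1 h2
        simpa using ⟨h1, h2⟩
    _ = b := by simp

omit hr [NeZero K] in
include hb in
lemma sum_batchRounds {M : Type*} [AddCommMonoid M] (f : Fin T → M) :
    ∑ i ∈ Finset.range B, ∑ t ∈ batchRounds T b i, f t = ∑ t, f t :=
  Finset.sum_fiberwise_of_maps_to
    (fun t _ => Finset.mem_range.2 (Nat.div_lt_of_lt_mul (t.2.trans_le hb))) f

lemma expectedRegret_batchedExpWeights_le {η : ℝ} (hη : 0 < η) (hb0 : 0 < b) :
    (batchedExpWeights K T B η b hb).expectedRegret r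
      ≤ Real.log K / η + η / 2 * (T * (K + b)) := by
  have hpath : ∀ (k : Fin K) (a : Fin T → Fin K), ∑ t, (1 - r (a t) t)
      ≤ ∑ t, roundEstimate η b r k t a + (Real.log K / η + η / 2 * ∑ i ∈ Finset.range B,
        ∑ j, armLaw η b r i a j * (∑ t ∈ batchRounds T b i, roundEstimate η b r j t a) ^ 2) := by
    intro k a
    have h := expWeights_regret hη
      (c := fun i j => ∑ t ∈ batchRounds T b i, roundEstimate η b r j t a)
      (fun i j => Finset.sum_nonneg fun t _ => by
        rw [roundEstimate]
        split_ifs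
        · exact div_nonneg (by linarith [(hr j t).2]) (armLaw_pos η b r _ a j).le
        · exact le_rfl) B k
    have hq : ∀ i, expWeights η (fun j => ∑ l ∈ Finset.range i,
        ∑ t ∈ batchRounds T b l, roundEstimate η b r j t a) = armLaw η b r i a := by
      intro i
      rw [armLaw]
      congr 1
      funext j
      rw [lossEstimate_eq_sum]
    simp only [hq] at h
    rw [sum_batchRounds hb] at h
    refine le_trans (le_of_eq ?_) h
    rw [← sum_batchRounds hb]
    refine Finset.sum_congr rfl fun i _ => ?_
    simp_rw [Finset.mul_sum]
    rw [Finset.sum_comm]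
    refine Finset.sum_congr rfl fun t ht => ?_
    have hti : (t : ℕ) / b = i := mem_batchRounds.1 ht
    rw [← hti, sum_armLaw_mul_roundEstimate]
  rw [NonAdaptivePolicy.expectedRegret, sub_le_iff_le_add]
  refine ciSup_le fun k => ?_
  have h := NonAdaptivePolicy.expect_mono (batchedExpWeights K T B η b hb) r (hpath k)
  simp only [NonAdaptivePolicy.expect_add, NonAdaptivePolicy.expect_const_mul,
    NonAdaptivePolicy.expect_sum Finset.univ, NonAdaptivePolicy.expect_sum (Finset.range B),
    NonAdaptivePolicy.expect_sub, NonAdaptivePolicy.expect_const] at h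
  have hunb : ∀ t, (batchedExpWeights K T B η b hb).expect r (roundEstimate η b r k t)
      = 1 - r k t := by
    intro t
    have := expect_mul_roundEstimate η hb r k t (φ := fun _ => 1) fun _ _ _ => rfl
    simpa [NonAdaptivePolicy.expect_const] using this
  have hvar : ∑ i ∈ Finset.range B, (batchedExpWeights K T B η b hb).expect r
      (fun a => ∑ j, armLaw η b r i a j *
        (∑ t ∈ batchRounds T b i, roundEstimate η b r j t a) ^ 2) ≤ T * (K + b) := by
    refine (Finset.sum_le_sum fun i _ =>
      expect_sum_armLaw_mul_sq_le η hb hr i (card_batchRounds_le hb0 i)).trans_eq ?_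
    rw [← Finset.sum_mul]
    have := sum_batchRounds hb (fun _ => (1 : ℝ))
    simp only [Finset.sum_const, nsmul_eq_mul, mul_one, Finset.card_univ, Fintype.card_fin] at this
    rw [this]
  have hvar' := mul_le_mul_of_nonneg_left hvar (half_pos hη).le
  simp only [NonAdaptivePolicy.expect_sum Finset.univ] at hvar'
  simp only [hunb, Finset.sum_sub_distrib] at h
  rw [← NonAdaptivePolicy.expectedReward_eq_sum] at h
  linarith

end

/-- Batched exponential weights with `η = √(log K / (T (K + T / B)))`. -/
lemma minimaxRegret_le_sqrt {K T B : ℕ} (hK : 2 ≤ K) (hB : 1 ≤ B) (hBT : B ≤ T) :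
    minimaxRegret K T B ≤
      ((2 * √((T : ℝ) * ((K : ℝ) + (T : ℝ) / (B : ℝ)) * Real.log (K : ℝ)) : ℝ) : EReal) := by
  have : NeZero K := ⟨by omega⟩
  have hK' : (2 : ℝ) ≤ K := by exact_mod_cast hK
  have hB' : (1 : ℝ) ≤ B := by exact_mod_cast hB
  have hBT' : (B : ℝ) ≤ T := by exact_mod_cast hBT
  have hT' : (0 : ℝ) < T := by linarith
  have hlog : 0 < Real.log K := Real.log_pos (by linarith)
  -- Batches of length `⌈T / B⌉`.
  set b := (T + B - 1) / B with hbdef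
  have hb : T ≤ b * B := by
    have h1 := Nat.lt_div_mul_add (show 0 < B by omega) (a := T + B - 1)
    rw [← hbdef] at h1
    omega
  have hb0 : 0 < b := Nat.div_pos (by omega) (by omega)
  have hbB : b * B ≤ 2 * T := (Nat.div_mul_le_self _ _).trans (by omega)
  have hbT : (b : ℝ) ≤ 2 * (T / B) := by
    rw [← mul_div_assoc, le_div_iff₀ (by linarith)]
    exact_mod_cast hbB
  set V : ℝ := T * (K + T / B) with hV
  have hV0 : 0 < V := by positivity
  have hη : 0 < √(Real.log K / V) := Real.sqrt_pos.2 (by positivity)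
  refine minimaxRegret_le (batchedExpWeights K T B (√(Real.log K / V)) b hb) fun r hr => ?_
  refine (expectedRegret_batchedExpWeights_le hb hr hη hb0).trans ?_
  have h1 : √(Real.log K / V) / 2 * (T * (K + b)) ≤ √(Real.log K / V) * V := by
    have : (T : ℝ) * (K + b) ≤ 2 * V := by
      rw [hV]
      nlinarith
    nlinarith
  have h2 : Real.log K / √(Real.log K / V) = √(V * Real.log K) := by
    rw [Real.sqrt_div hlog.le, Real.sqrt_mul hV0.le, div_div_eq_mul_div, mul_comm, mul_div_assoc,
      Real.div_sqrt]
  have h3 : √(Real.log K / V) * V = √(V * Real.log K) := by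
    rw [Real.sqrt_div hlog.le, Real.sqrt_mul hV0.le, div_mul_eq_mul_div, mul_div_assoc,
      Real.div_sqrt, mul_comm]
  linarith

theorem theorem3 :
    ∃ c C : ℝ, 0 < c ∧ 0 < C ∧
      ∀ K T B : ℕ, 2 ≤ K → 1 ≤ B → B ≤ T →
        minimaxRegret K T B ≤
          ((C * √((T : ℝ) * ((K : ℝ) + (T : ℝ) / (B : ℝ)) * Real.log (K : ℝ)) : ℝ) : EReal) ∧
        (K ≤ T →
          ((c * √((T : ℝ) * ((K : ℝ) + (T : ℝ) / (B : ℝ))) : ℝ) : EReal) ≤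
            minimaxRegret K T B) ∧
        (T < K → ((c * (T : ℝ) : ℝ) : EReal) ≤ minimaxRegret K T B) := by
  refine ⟨1 / 128, 2, by norm_num, by norm_num, fun K T B hK hB hBT =>
    ⟨minimaxRegret_le_sqrt hK hB hBT, fun hKT => ?_, fun hTK => ?_⟩⟩
  · have h1 := le_minimaxRegret_sqrt (B := B) hK hKT
    have h2 := le_minimaxRegret_batch (T := T) hK hB
    have hsplit : (1 / 128 : ℝ) * √(T * (K + T / B))
        ≤ max (1 / 64 * √(K * T)) (5 / 18 * (T / √B)) := by
      have e : (T : ℝ) / √B = √(T * (T / B)) := by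
        rw [← mul_div_assoc, Real.sqrt_div (by positivity), Real.sqrt_mul_self (by positivity)]
      have h3 : √((T : ℝ) * (K + T / B)) ≤ √(K * T) + T / √B := by
        rw [e, mul_add, mul_comm (T : ℝ) K]
        apply Real.sqrt_le_iff.2
        refine ⟨by positivity, ?_⟩
        rw [add_sq, Real.sq_sqrt (by positivity), Real.sq_sqrt (by positivity)]
        have : 0 ≤ 2 * √((K : ℝ) * T) * √((T : ℝ) * (T / B)) := by positivity
        linarith
      have h4 := le_max_left (1 / 64 * √((K : ℝ) * T)) (5 / 18 * (T / √B))
      have h5 := le_max_right (1 / 64 * √((K : ℝ) * T)) (5 / 18 * (T / √B))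
      have h6 : 0 ≤ (T : ℝ) / √B := by positivity
      linarith
    refine (EReal.coe_le_coe_iff.2 hsplit).trans ?_
    rcases max_cases (1 / 64 * √((K : ℝ) * T)) (5 / 18 * (T / √B)) with h | h <;> rw [h.1]
    exacts [h1, h2]
  · refine le_trans (EReal.coe_le_coe_iff.2 ?_) (le_minimaxRegret_of_lt (B := B) hTK)
    have : (0 : ℝ) ≤ T := Nat.cast_nonneg T
    linarith
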